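/- Let $s\ge 0$ and $n\ge 1$ be integers, and let $a_i^\sim\in\mathbb C$, $a_i(\nu)\in\mathbb C$ ($0\le i\le n$, $\nu=0,1,2,\dots$) satisfy $a_n(\nu)=1$ and $a_i(\nu)-a_i^\sim=O(1/(\nu+1))$. For an integer $m\ge1$ let $V_m$ be the complex vector space of sequences $y(m),y(m+1),\dots$ with $$\sum_{k=0}^n a_k(\nu)\,y(\nu+k)=0\qquad(\nu\ge m),$$ and put $\omega_{n,y}(\nu)=\max(|y(\nu)|,\dots,|y(\nu+n-1)|)$. Let $\rho_1>\rho_2>\dots>\rho_{s+1}=0$ be such that the absolute value of every root of $T(z)=\sum_{k=0}^n a_k^\sim z^k$ is one of the $\rho_i$. Let $e_i$ and $k_i$ be the sum and the maximum of the multiplicities of the roots of $T$ of absolute value $\rho_i$ (both $0$ if there are none), let $k^\ast=k_{s+1}$, and suppose $e_i>0$ for $1\le i\le s$. Let $k=\max(k_1,\dots,k_s)$. Call $(A,m,\alpha,(V_{m,i}^\vee)_{1\le i\le s+1})$, with $A>0$, $m\ge1$, positive numbers $\alpha(\nu)\to0$ ($\nu\ge m$) and subspaces $V_{m,i}^\vee\subseteq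 V_m$, a growth decomposition if $V_m=V_{m,1}^\vee\oplus\dots\oplus V_{m,s+1}^\vee$, $\dim_{\mathbb C}V_{m,i}^\vee=e_i$ for $1\le i\le s+1$, and, for all $\nu\ge m$ and all $\theta\in\{1,\dots,s\}$, with $V_{m,\theta}^\wedge=V_{m,\theta}^\vee\oplus\dots\oplus V_{m,s+1}^\vee$, the natural projection $\pi_\theta:V_{m,\theta}^\wedge\to V_{m,\theta}^\vee$, and $g_\theta(\nu)=\ln\nu+\nu^{1-1/k_\theta}$: * $e^{-A g_\theta(\nu)}\rho_\theta^\nu\,\omega_{n,y}(m)\le\omega_{n,y}(\nu)$ for $y\in V_{m,\theta}^\vee$; * $\omega_{n,y}(\nu)\le e^{A g_\theta(\nu)}\rho_\theta^\nu\,\omega_{n,y}(m)$ and $\bigl(\omega_{n,\pi_\theta(y)}(m)-\alpha(\nu)\,\omega_{n,y}(m)\bigr)\rho_\theta^\nu e^{-A g_\theta(\nu)}\le\omega_{n,y}(\nu)$ for $y\in V_{m,\theta}^\wedge$; * if $k^\ast>0$, then $|y(\nu)|\le(A/\nu)^{\nu/k^\ast}\omega_{n,y}(m)$ for $y\in V_{m,s+1}^\vee$.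 Then a growth decomposition exists. Moreover, for every growth decomposition and every $\theta\in\{1,\dots,s\}$ there is a constant $A^\ast>0$ such that, with $V_{m,\theta}^\ast=V_{m,1}^\vee\oplus\dots\oplus V_{m,\theta}^\vee$, $$\exp\bigl(-A^\ast(\ln\nu+\nu^{1-1/k})\bigr)\,\rho_\theta^{\nu}\,\omega_{n,y}(m)\le\omega_{n,y}(\nu)\qquad\text{for all }y\in V_{m,\theta}^\ast\text{ and all }\nu\ge m.$$ -/

import Mathlib

open Filter Asymptotics Topology Polynomial

noncomputable section

namespace PoincareEq

/-- The point `ν + j` of the half-line `{m, m + 1, …}`, for `ν` in it. -/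
def shift {m : ℕ} (ν : Set.Ici m) (j : ℕ) : Set.Ici m :=
  ⟨(ν : ℕ) + j, le_trans ν.2 (Nat.le_add_right _ _)⟩

/-- The first point `m` of the half-line `{m, m + 1, …}`. -/
def start (m : ℕ) : Set.Ici m := ⟨m, le_refl m⟩

/-- `V_m`: the complex vector space of the sequences `y(m), y(m+1), …` with
`∑_{k=0}^n a_k(ν) y(ν+k) = 0` for all `ν ≥ m`. -/
def solutionSpace (n : ℕ) (a : ℕ → ℕ → ℂ) (m : ℕ) : Submodule ℂ (Set.Ici m → ℂ) where
  carrier := {y | ∀ ν : Set.Ici m, ∑ k ∈ Finset.range (n + 1), a k ν * y (shift ν k) = 0}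
  add_mem' := by
    intro y z hy hz ν
    simp only [Pi.add_apply, mul_add, Finset.sum_add_distrib]
    rw [hy ν, hz ν, add_zero]
  zero_mem' := by
    intro ν
    simp
  smul_mem' := by
    intro c y hy ν
    have h : ∀ k, a k ν * (c • y) (shift ν k) = c * (a k ν * y (shift ν k)) := by
      intro k
      simp only [Pi.smul_apply, smul_eq_mul]
      ring
    simp only [h, ← Finset.mul_sum]
    rw [hy ν, mul_zero]

/-- `ω_{n,y}(ν) = max (|y(ν)|, …, |y(ν+n-1)|)`
(the norm of a finite product is the supremum norm). -/
def omega (n : ℕ) {m : ℕ} (y : Set.Ici m → ℂ) (ν : Set.Ici m) : ℝ :=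
  ‖fun j : Fin n => y (shift ν j)‖

/-- The characteristic polynomial `T(z) = ∑_{k=0}^n a~_k z^k`. -/
def charPol (n : ℕ) (aLim : ℕ → ℂ) : ℂ[X] :=
  ∑ k ∈ Finset.range (n + 1), C (aLim k) * X ^ k

/-- The sum of the multiplicities of the roots of `T` of absolute value `r`. -/
def multSum (T : ℂ[X]) (r : ℝ) : ℕ :=
  ∑ z ∈ T.roots.toFinset.filter (fun z => ‖z‖ = r), T.rootMultiplicity z

/-- The maximum of the multiplicities of the roots of `T` of absolute value `r`
(`0` if there are none). -/
def multMax (T : ℂ[X]) (r : ℝ) : ℕ :=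
  (T.roots.toFinset.filter (fun z => ‖z‖ = r)).sup (fun z => T.rootMultiplicity z)

/-- The rate `ln ν + ν^{1 - 1/k}`. -/
def rate (k : ℕ) (ν : ℕ) : ℝ :=
  Real.log (ν : ℝ) + (ν : ℝ) ^ (1 - 1 / (k : ℝ))

/-- `V_j^∧ = V_j ⊕ … ⊕ V_{s+1}` (indices start at `0` in Lean). -/
def upperSum {s : ℕ} {M : Type*} [AddCommGroup M] [Module ℂ M]
    (V : Fin (s + 1) → Submodule ℂ M) (j : Fin (s + 1)) : Submodule ℂ M :=
  ⨆ i : Fin (s + 1), ⨆ _ : j ≤ i, V i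

/-- `V_j^* = V_1 ⊕ … ⊕ V_j` (indices start at `0` in Lean). -/
def lowerSum {s : ℕ} {M : Type*} [AddCommGroup M] [Module ℂ M]
    (V : Fin (s + 1) → Submodule ℂ M) (j : Fin (s + 1)) : Submodule ℂ M :=
  ⨆ i : Fin (s + 1), ⨆ _ : i ≤ j, V i

/-- The projection onto the `j`-th summand of an internal direct sum. Its restriction to
`upperSum V j` is the natural projection of that space onto `V j`. -/
def proj {s : ℕ} {M : Type*} [AddCommGroup M] [Module ℂ M]
    {V : Fin (s + 1) → Submodule ℂ M} (h : DirectSum.IsInternal V) (j : Fin (s + 1)) :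
    M →ₗ[ℂ] V j :=
  (DirectSum.component ℂ (Fin (s + 1)) (fun i => V i) j).comp
    (LinearEquiv.ofBijective (DirectSum.coeLinearMap V) h).symm.toLinearMap

/-- The subspaces `V 0, …, V s` of `V_m` (together with `A`, `m` and `α`) form a growth
decomposition of the solution space of the equation with coefficients `a`, whose
characteristic polynomial is `T` with roots of absolute values among `ρ 0 > … > ρ s = 0`. -/
structure IsGrowthDecomposition (n s : ℕ) (a : ℕ → ℕ → ℂ) (T : ℂ[X]) (ρ : Fin (s + 1) → ℝ)
    (A : ℝ) (m : ℕ) (α : ℕ → ℝ) (V : Fin (s + 1) → Submodule ℂ (solutionSpace n a m)) :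
    Prop where
  A_pos : 0 < A
  m_pos : 1 ≤ m
  α_pos : ∀ ν : ℕ, m ≤ ν → 0 < α ν
  α_tendsto : Tendsto α atTop (𝓝 0)
  isInternal : DirectSum.IsInternal V
  finrank_eq : ∀ i : Fin (s + 1), Module.finrank ℂ (V i) = multSum T (ρ i)
  /-- Lower bound on each of the first `s` summands. -/
  lower : ∀ θ : Fin s, ∀ y ∈ V θ.castSucc, ∀ ν : Set.Ici m,
    Real.exp (-A * rate (multMax T (ρ θ.castSucc)) ν) * ρ θ.castSucc ^ (ν : ℕ)
        * omega n (y : Set.Ici m → ℂ) (start m)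
      ≤ omega n (y : Set.Ici m → ℂ) ν
  /-- Upper bound on the sum of the summands from the `θ`-th on. -/
  upper : ∀ θ : Fin s, ∀ y ∈ upperSum V θ.castSucc, ∀ ν : Set.Ici m,
    omega n (y : Set.Ici m → ℂ) ν
      ≤ Real.exp (A * rate (multMax T (ρ θ.castSucc)) ν) * ρ θ.castSucc ^ (ν : ℕ)
        * omega n (y : Set.Ici m → ℂ) (start m)
  /-- Lower bound on the same sum, through the natural projection onto the `θ`-th summand. -/
  lower_proj : ∀ θ : Fin s, ∀ y ∈ upperSum V θ.castSucc, ∀ ν : Set.Ici m,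
    (omega n (((proj isInternal θ.castSucc y : V θ.castSucc) : solutionSpace n a m) :
          Set.Ici m → ℂ) (start m)
        - α ν * omega n (y : Set.Ici m → ℂ) (start m))
      * ρ θ.castSucc ^ (ν : ℕ) * Real.exp (-A * rate (multMax T (ρ θ.castSucc)) ν)
      ≤ omega n (y : Set.Ici m → ℂ) ν
  /-- Superexponential decay on the last summand. -/
  decay : 0 < multMax T (ρ (Fin.last s)) → ∀ y ∈ V (Fin.last s), ∀ ν : Set.Ici m,
    ‖(y : Set.Ici m → ℂ) ν‖
      ≤ (A / ((ν : ℕ) : ℝ)) ^ (((ν : ℕ) : ℝ) / (multMax T (ρ (Fin.last s)) : ℝ))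
        * omega n (y : Set.Ici m → ℂ) (start m)

end PoincareEq

end

open PoincareEq

/-!
The cofactors `T / (X - z) ^ j`, applied to the shift operator and weighted by suitable powers of
`ν`, are coordinates in which the equation becomes a perturbation of size `O(ν ^ (-1 / k))` of the
diagonal system formed by the roots of `T`. For each gap between the moduli `ρ i`, the part of a
solution belonging to the larger roots and the part belonging to the smaller ones satisfy a
dichotomy: once the former is dominant it stays so. This splits the solution space by growth rate,
and multiplying the one-step estimates on a summand gives `ρ i ^ ν` up to `exp (A * rate k ν)`.

A sum of several summands might suffer cancellation at the given `ν`. However, as the components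
grow at separated rates, after `O(rate k ν)` further steps one of them outweighs the others, and the
bound obtained there is carried back to `ν`, each step backwards costing a constant factor.
-/

namespace PoincareEq

section Dichotomy

/-- Two nonnegative sequences, the sizes of the expanding and of the contracting part of an orbit:
`h` grows at least by the factor `r + γ` and `l` at most by the factor `r - γ`, both up to an error
of `γ / 3` times the size `max h l` of the orbit. -/
structure IsDichotomy (r γ : ℝ) (h l : ℕ → ℝ) : Prop where
  high_nonneg : ∀ t, 0 ≤ h t
  low_nonneg : ∀ t, 0 ≤ l t
  le_high_succ : ∀ t, (r + γ) * h t - γ / 3 * max (h t) (l t) ≤ h (t + 1)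
  low_succ_le : ∀ t, l (t + 1) ≤ (r - γ) * l t + γ / 3 * max (h t) (l t)

namespace IsDichotomy

variable {r γ : ℝ} {h l : ℕ → ℝ} (hd : IsDichotomy r γ h l) (hγ : 0 < γ) (hr : γ ≤ r)

include hd hγ hr

lemma low_le_two_mul_high_succ {t : ℕ} (ht : l t ≤ 2 * h t) :
    l (t + 1) ≤ 2 * h (t + 1) ∧ (r + γ / 3) * h t ≤ h (t + 1) := by
  have hh := hd.high_nonneg t
  have hmax : γ * max (h t) (l t) ≤ γ * (2 * h t) :=
    mul_le_mul_of_nonneg_left (max_le (by linarith) ht) hγ.le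
  have hlow : (r - γ) * l t ≤ (r - γ) * (2 * h t) :=
    mul_le_mul_of_nonneg_left ht (sub_nonneg.2 hr)
  have hpos : 0 ≤ γ * h t := mul_nonneg hγ.le hh
  constructor <;> linarith [hd.le_high_succ t, hd.low_succ_le t]

lemma low_le_two_mul_high_add {t : ℕ} (ht : l t ≤ 2 * h t) (k : ℕ) :
    l (t + k) ≤ 2 * h (t + k) ∧ (r + γ / 3) ^ k * h t ≤ h (t + k) := by
  induction k with
  | zero => simpa using ht
  | succ k ih =>
    obtain ⟨hcone, hgrow⟩ := hd.low_le_two_mul_high_succ hγ hr ih.1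
    refine ⟨hcone, le_trans ?_ hgrow⟩
    rw [pow_succ', mul_assoc]
    exact mul_le_mul_of_nonneg_left ih.2 (by linarith)

lemma two_mul_low_le_high (h0 : 2 * l 0 ≤ h 0) (t : ℕ) : 2 * l t ≤ h t := by
  induction t with
  | zero => exact h0
  | succ t ih =>
    have hh := hd.high_nonneg t
    have hmax : γ * max (h t) (l t) ≤ γ * h t :=
      mul_le_mul_of_nonneg_left (max_le le_rfl (by linarith [hd.low_nonneg t])) hγ.le
    have hlow : (r - γ) * (2 * l t) ≤ (r - γ) * h t :=
      mul_le_mul_of_nonneg_left ih (sub_nonneg.2 hr)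
    have hpos : 0 ≤ γ * h t := mul_nonneg hγ.le hh
    linarith [hd.le_high_succ t, hd.low_succ_le t]

lemma two_mul_high_le_low_of_le_pow {C : ℝ} (hC : ∀ t, h t ≤ C * r ^ t) (t : ℕ) :
    2 * h t ≤ l t := by
  by_contra! hcon
  have hpos : 0 < h t := by linarith [hd.low_nonneg t]
  have hr0 : 0 < r := hγ.trans_le hr
  have hbound (k : ℕ) : ((r + γ / 3) / r) ^ k ≤ C * r ^ t / h t := by
    rw [div_pow, le_div_iff₀ hpos, div_mul_eq_mul_div, div_le_iff₀ (pow_pos hr0 k)]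
    calc (r + γ / 3) ^ k * h t
        ≤ h (t + k) := (hd.low_le_two_mul_high_add hγ hr (by linarith) k).2
      _ ≤ C * r ^ (t + k) := hC _
      _ = C * r ^ t * r ^ k := by ring
  obtain ⟨k, hk⟩ := pow_unbounded_of_one_lt (C * r ^ t / h t)
    (show 1 < (r + γ / 3) / r by rw [one_lt_div hr0]; linarith)
  exact (hbound k).not_gt hk

lemma two_mul_high_le_low_of_eq_zero {N t : ℕ} (hN : h N = 0) (ht : t ≤ N) :
    2 * h t ≤ l t := by
  by_contra! hcon
  have hpos : 0 < h t := by linarith [hd.low_nonneg t]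
  have hgrow := (hd.low_le_two_mul_high_add hγ hr (by linarith : l t ≤ 2 * h t) (N - t)).2
  rw [Nat.add_sub_cancel' ht, hN] at hgrow
  exact hgrow.not_gt (mul_pos (pow_pos (by linarith) _) hpos)

lemma low_le_mul_pow (hdom : ∀ t, 2 * h t ≤ l t) (t : ℕ) : l t ≤ l 0 * r ^ t := by
  induction t with
  | zero => simp
  | succ t ih =>
    have hl := hd.low_nonneg t
    have hstep := hd.low_succ_le t
    rw [max_eq_right (by linarith [hdom t, hd.high_nonneg t])] at hstep
    calc l (t + 1) ≤ (r - γ) * l t + γ / 3 * l t := hstep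
      _ ≤ r * l t := by nlinarith
      _ ≤ r * (l 0 * r ^ t) := mul_le_mul_of_nonneg_left ih (hγ.le.trans hr)
      _ = l 0 * r ^ (t + 1) := by ring

end IsDichotomy

end Dichotomy

section PartNorm

variable {ι E : Type*} [SeminormedAddCommGroup E] {s : Finset ι} {v : ι → E} {c d : ℝ}

/-- The supremum norm of the part of a vector supported on `s`. -/
noncomputable def partNorm (s : Finset ι) (v : ι → E) : ℝ := ‖s.restrict v‖

lemma partNorm_nonneg : 0 ≤ partNorm s v := norm_nonneg _

lemma norm_le_partNorm {i : ι} (hi : i ∈ s) : ‖v i‖ ≤ partNorm s v :=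
  norm_le_pi_norm (s.restrict v) ⟨i, hi⟩

lemma partNorm_le (hc : 0 ≤ c) (h : ∀ i ∈ s, ‖v i‖ ≤ c) : partNorm s v ≤ c :=
  (pi_norm_le_iff_of_nonneg hc).2 fun i => h i i.2

lemma partNorm_eq_zero (h : ∀ i ∈ s, v i = 0) : partNorm s v = 0 :=
  le_antisymm (partNorm_le le_rfl fun i hi => by rw [h i hi, norm_zero]) partNorm_nonneg

lemma partNorm_le_norm [Fintype ι] : partNorm s v ≤ ‖v‖ :=
  partNorm_le (norm_nonneg _) fun i _ => norm_le_pi_norm v i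

lemma mul_partNorm_le (hd : 0 ≤ d) (h : ∀ i ∈ s, c * ‖v i‖ ≤ d) : c * partNorm s v ≤ d := by
  rcases le_or_gt c 0 with hc | hc
  · exact (mul_nonpos_of_nonpos_of_nonneg hc partNorm_nonneg).trans hd
  · rw [← le_div_iff₀' hc]
    exact partNorm_le (by positivity) fun i hi => (le_div_iff₀' hc).2 (h i hi)

end PartNorm

section PerturbedOrbit

variable {ι 𝕜 : Type*} [NormedField 𝕜] {lam : ι → 𝕜} {r γ : ℝ}

/-- No eigenvalue has its absolute value within `γ` of `r`. -/
def HasGap (lam : ι → 𝕜) (r γ : ℝ) : Prop := ∀ i, ‖lam i‖ ≤ r - γ ∨ r + γ ≤ ‖lam i‖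

variable [Fintype ι]

/-- The indices of the eigenvalues of absolute value above `r`. -/
noncomputable def high (lam : ι → 𝕜) (r : ℝ) : Finset ι := {i | r < ‖lam i‖}

/-- The indices of the eigenvalues of absolute value at most `r`. -/
noncomputable def low (lam : ι → 𝕜) (r : ℝ) : Finset ι := {i | ‖lam i‖ ≤ r}

lemma mem_high {i : ι} : i ∈ high lam r ↔ r < ‖lam i‖ := by simp [high]

lemma mem_low {i : ι} : i ∈ low lam r ↔ ‖lam i‖ ≤ r := by simp [low]

lemma norm_eq_max_partNorm (lam : ι → 𝕜) (r : ℝ) (v : ι → 𝕜) :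
    ‖v‖ = max (partNorm (high lam r) v) (partNorm (low lam r) v) := by
  refine le_antisymm ?_ (max_le partNorm_le_norm partNorm_le_norm)
  refine (pi_norm_le_iff_of_nonneg (le_max_of_le_left partNorm_nonneg)).2 fun i => ?_
  rcases lt_or_ge r ‖lam i‖ with hi | hi
  · exact le_max_of_le_left (norm_le_partNorm (mem_high.2 hi))
  · exact le_max_of_le_right (norm_le_partNorm (mem_low.2 hi))

lemma norm_eq_partNorm_low {v : ι → 𝕜}
    (h : 2 * partNorm (high lam r) v ≤ partNorm (low lam r) v) :
    ‖v‖ = partNorm (low lam r) v := by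
  rw [norm_eq_max_partNorm lam r, max_eq_right]
  linarith [partNorm_nonneg (s := high lam r) (v := v)]

/-- The sequence `x` is an orbit of the diagonal matrix with entries `lam`, up to an error of `δ`
times the norm of `x` in each step. -/
def IsPerturbedOrbit (lam : ι → 𝕜) (δ : ℝ) (x : ℕ → ι → 𝕜) : Prop :=
  ∀ t i, ‖x (t + 1) i - lam i * x t i‖ ≤ δ * ‖x t‖

lemma IsPerturbedOrbit.isDichotomy {x : ℕ → ι → 𝕜} (hx : IsPerturbedOrbit lam (γ / 3) x)
    (hγ : 0 < γ) (hr : γ ≤ r) (hgap : HasGap lam r γ) :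
    IsDichotomy r γ (fun t => partNorm (high lam r) (x t))
      fun t => partNorm (low lam r) (x t) where
  high_nonneg t := partNorm_nonneg
  low_nonneg t := partNorm_nonneg
  le_high_succ t := by
    rw [← norm_eq_max_partNorm, sub_le_iff_le_add]
    refine mul_partNorm_le (add_nonneg partNorm_nonneg (by positivity)) fun i hi => ?_
    have hlam : r + γ ≤ ‖lam i‖ := (hgap i).resolve_left fun h => by linarith [mem_high.1 hi]
    calc (r + γ) * ‖x t i‖ ≤ ‖lam i * x t i‖ := by rw [norm_mul]; gcongr
      _ ≤ ‖x (t + 1) i‖ + ‖x (t + 1) i - lam i * x t i‖ :=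
          norm_le_norm_add_norm_sub _ _
      _ ≤ _ := add_le_add (norm_le_partNorm hi) (hx t i)
  low_succ_le t := by
    rw [← norm_eq_max_partNorm]
    have hrγ : 0 ≤ r - γ := sub_nonneg.2 hr
    have hnonneg := partNorm_nonneg (s := low lam r) (v := x t)
    refine partNorm_le (by positivity) fun i hi => ?_
    have hlam : ‖lam i‖ ≤ r - γ := (hgap i).resolve_right fun h => by linarith [mem_low.1 hi]
    calc ‖x (t + 1) i‖ ≤ ‖lam i * x t i‖ + ‖x (t + 1) i - lam i * x t i‖ :=
          norm_le_norm_add_norm_sub' _ _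
      _ ≤ _ := by
        rw [norm_mul]
        exact add_le_add (mul_le_mul hlam (norm_le_partNorm hi) (norm_nonneg _) hrγ) (hx t i)

end PerturbedOrbit

section Slow

variable {ι 𝕜 S : Type*} [Fintype ι] [NontriviallyNormedField 𝕜] [AddCommGroup S] [Module 𝕜 S]

/-- The elements whose orbit under `F` grows at most as fast as `r ^ t`. -/
def slow (F : ℕ → S →ₗ[𝕜] (ι → 𝕜)) (r : ℝ) : Submodule 𝕜 S where
  carrier := {y | ∃ C : ℝ, ∀ t, ‖F t y‖ ≤ C * r ^ t}
  add_mem' := by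
    rintro y z ⟨C, hC⟩ ⟨D, hD⟩
    refine ⟨C + D, fun t => ?_⟩
    rw [map_add, add_mul]
    exact (norm_add_le _ _).trans (add_le_add (hC t) (hD t))
  zero_mem' := ⟨0, fun t => by simp⟩
  smul_mem' := by
    rintro c y ⟨C, hC⟩
    refine ⟨‖c‖ * C, fun t => ?_⟩
    rw [map_smul, norm_smul, mul_assoc]
    exact mul_le_mul_of_nonneg_left (hC t) (norm_nonneg _)

variable {F : ℕ → S →ₗ[𝕜] (ι → 𝕜)} {lam : ι → 𝕜} {r γ : ℝ} {y : S}

lemma slow_mono {r' : ℝ} (hr : 0 ≤ r) (h : r ≤ r') : slow F r ≤ slow F r' := by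
  rintro y ⟨C, hC⟩
  have hC0 : 0 ≤ C := by simpa using (norm_nonneg _).trans (hC 0)
  exact ⟨C, fun t => (hC t).trans (by gcongr)⟩

variable (hγ : 0 < γ) (hr : γ ≤ r) (hgap : HasGap lam r γ)
  (hF : ∀ y, IsPerturbedOrbit lam (γ / 3) fun t => F t y)

include hγ hr hgap hF

lemma two_mul_partNorm_high_le_of_mem_slow (hy : y ∈ slow F r) (t : ℕ) :
    2 * partNorm (high lam r) (F t y) ≤ partNorm (low lam r) (F t y) := by
  obtain ⟨C, hC⟩ := hy
  exact ((hF y).isDichotomy hγ hr hgap).two_mul_high_le_low_of_le_pow hγ hr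
    (fun t => partNorm_le_norm.trans (hC t)) t

lemma norm_eq_partNorm_low_of_mem_slow (hy : y ∈ slow F r) (t : ℕ) :
    ‖F t y‖ = partNorm (low lam r) (F t y) :=
  norm_eq_partNorm_low (two_mul_partNorm_high_le_of_mem_slow hγ hr hgap hF hy t)

lemma norm_le_norm_zero_mul_pow
    (hdom : ∀ t, 2 * partNorm (high lam r) (F t y) ≤ partNorm (low lam r) (F t y)) (t : ℕ) :
    ‖F t y‖ ≤ ‖F 0 y‖ * r ^ t := by
  rw [norm_eq_partNorm_low (hdom t), norm_eq_partNorm_low (hdom 0)]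
  exact ((hF y).isDichotomy hγ hr hgap).low_le_mul_pow hγ hr hdom t

lemma eq_zero_of_mem_slow (hF0 : Function.Injective (F 0)) (hy : y ∈ slow F r)
    (h : ∀ i ∈ low lam r, F 0 y i = 0) : y = 0 := by
  refine (map_eq_zero_iff _ hF0).1 (norm_eq_zero.1 ?_)
  rw [norm_eq_partNorm_low_of_mem_slow hγ hr hgap hF hy, partNorm_eq_zero h]

lemma exists_low_eq_high_eq_zero (hF0 : Function.Bijective (F 0)) (u : ι → 𝕜) (N : ℕ) :
    ∃ y : S, (∀ i ∈ low lam r, F 0 y i = u i) ∧ ∀ i ∈ high lam r, F N y i = 0 := by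
  let Φ : S →ₗ[𝕜] (ι → 𝕜) := LinearMap.pi fun i =>
    LinearMap.proj i ∘ₗ if r < ‖lam i‖ then F N else F 0
  have hΦhigh (y : S) (i : ι) (hi : i ∈ high lam r) : Φ y i = F N y i := by
    simp [Φ, mem_high.1 hi]
  have hΦlow (y : S) (i : ι) (hi : i ∈ low lam r) : Φ y i = F 0 y i := by
    simp [Φ, (mem_low.1 hi).not_gt]
  have hinj : Function.Injective Φ := by
    refine (injective_iff_map_eq_zero Φ).2 fun y hy => ?_
    have hlow : partNorm (low lam r) (F 0 y) = 0 :=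
      partNorm_eq_zero fun i hi => by rw [← hΦlow y i hi, hy, Pi.zero_apply]
    have hhigh : partNorm (high lam r) (F N y) = 0 :=
      partNorm_eq_zero fun i hi => by rw [← hΦhigh y i hi, hy, Pi.zero_apply]
    have hdom := ((hF y).isDichotomy hγ hr hgap).two_mul_high_le_low_of_eq_zero hγ hr
      hhigh N.zero_le
    refine (map_eq_zero_iff _ hF0.1).1 (norm_eq_zero.1 ?_)
    rw [norm_eq_partNorm_low hdom, hlow]
  let e : S ≃ₗ[𝕜] (ι → 𝕜) := LinearEquiv.ofBijective (F 0) hF0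
  have := e.symm.finiteDimensional
  obtain ⟨y, hy⟩ := (LinearMap.injective_iff_surjective_of_finrank_eq_finrank e.finrank_eq).1 hinj
    fun i => if r < ‖lam i‖ then 0 else u i
  refine ⟨y, fun i hi => ?_, fun i hi => ?_⟩
  · rw [← hΦlow y i hi, hy]
    exact if_neg (mem_low.1 hi).not_gt
  · rw [← hΦhigh y i hi, hy]
    exact if_pos (mem_high.1 hi)

/-- The low part at time `0` can be prescribed for an orbit whose high part vanishes at time `N`;
compactness yields an orbit whose low part dominates at all times. -/
lemma exists_mem_slow_low_eq [ProperSpace 𝕜] (hF0 : Function.Bijective (F 0)) (u : ι → 𝕜) :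
    ∃ y ∈ slow F r, ∀ i ∈ low lam r, F 0 y i = u i := by
  let e : S ≃ₗ[𝕜] (ι → 𝕜) := LinearEquiv.ofBijective (F 0) hF0
  have he (c : ι → 𝕜) : F 0 (e.symm c) = c := e.apply_symm_apply c
  let K (N : ℕ) : Set (ι → 𝕜) := {c | (∀ i ∈ low lam r, c i = u i) ∧ ∀ t ≤ N,
    2 * partNorm (high lam r) (F t (e.symm c)) ≤ partNorm (low lam r) (F t (e.symm c))}
  have hK_anti (N : ℕ) : K (N + 1) ⊆ K N := fun c hc =>
    ⟨hc.1, fun t ht => hc.2 t (ht.trans N.le_succ)⟩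
  have hK_nonempty (N : ℕ) : (K N).Nonempty := by
    obtain ⟨y, hlow, hhigh⟩ := exists_low_eq_high_eq_zero hγ hr hgap hF hF0 u N
    refine ⟨F 0 y, hlow, fun t ht => ?_⟩
    rw [show e.symm (F 0 y) = y from e.symm_apply_apply y]
    exact ((hF y).isDichotomy hγ hr hgap).two_mul_high_le_low_of_eq_zero hγ hr
      (partNorm_eq_zero hhigh) ht
  have hK_closed (N : ℕ) : IsClosed (K N) := by
    have hcont (s : Finset ι) (t : ℕ) : Continuous fun c => partNorm s (F t (e.symm c)) :=
      ((Finset.continuous_restrict s).comp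
        (F t ∘ₗ e.symm.toLinearMap).continuous_of_finiteDimensional).norm
    simp only [K, Set.ofPred_and, Set.ofPred_forall]
    exact (isClosed_biInter fun i _ => isClosed_eq (continuous_apply i) continuous_const).inter
      (isClosed_biInter fun t _ => isClosed_le ((hcont _ t).const_mul 2) (hcont _ t))
  have hK_compact : IsCompact (K 0) := by
    refine (isCompact_closedBall (0 : ι → 𝕜) ‖u‖).of_isClosed_subset (hK_closed 0) ?_
    intro c hc
    have hdom := hc.2 0 le_rfl
    rw [he] at hdom
    rw [mem_closedBall_zero_iff, norm_eq_partNorm_low hdom]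
    exact partNorm_le (norm_nonneg u) fun i hi => hc.1 i hi ▸ norm_le_pi_norm u i
  obtain ⟨c, hc⟩ := IsCompact.nonempty_iInter_of_sequence_nonempty_isCompact_isClosed K hK_anti
    hK_nonempty hK_compact hK_closed
  rw [Set.mem_iInter] at hc
  exact ⟨e.symm c, ⟨_, norm_le_norm_zero_mul_pow hγ hr hgap hF fun t => (hc t).2 t le_rfl⟩,
    fun i hi => by rw [he, (hc 0).1 i hi]⟩

end Slow

section GrowthSummand

variable {ι 𝕜 S : Type*}

/-- All absolute values of eigenvalues other than `q` have distance at least `2 * γ` from `q`. -/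
def IsIsolated [NormedField 𝕜] (lam : ι → 𝕜) (γ q : ℝ) : Prop :=
  ∀ i, ‖lam i‖ ≤ q - 2 * γ ∨ ‖lam i‖ = q ∨ q + 2 * γ ≤ ‖lam i‖

lemma IsIsolated.hasGap_add [NormedField 𝕜] {lam : ι → 𝕜} {γ q : ℝ} (h : IsIsolated lam γ q)
    (hγ : 0 < γ) : HasGap lam (q + γ) γ := by
  intro i
  rcases h i with h | h | h
  · left; linarith
  · left; linarith
  · right; linarith

lemma IsIsolated.hasGap_sub [NormedField 𝕜] {lam : ι → 𝕜} {γ q : ℝ} (h : IsIsolated lam γ q)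
    (hγ : 0 < γ) : HasGap lam (q - γ) γ := by
  intro i
  rcases h i with h | h | h
  · left; linarith
  · right; linarith
  · right; linarith

lemma IsIsolated.mem_low_iff [NormedField 𝕜] [Fintype ι] {lam : ι → 𝕜} {γ q : ℝ}
    (h : IsIsolated lam γ q) (hγ : 0 < γ) {i : ι} :
    i ∈ low lam (q + γ) ↔ ‖lam i‖ = q ∨ ‖lam i‖ < q := by
  rw [mem_low]
  constructor
  · intro hi
    rcases h i with h | h | h
    · right; linarith
    · left; exact h
    · linarith
  · rintro (hi | hi) <;> linarith

variable [Fintype ι] [NontriviallyNormedField 𝕜] [AddCommGroup S] [Module 𝕜 S]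

/-- The elements of growth at most `(q + γ) ^ t` whose coordinates at the eigenvalues of absolute
value below `q` vanish at time `0`: a complement of the elements of growth below `q ^ t`. -/
def growthSummand (F : ℕ → S →ₗ[𝕜] (ι → 𝕜)) (lam : ι → 𝕜) (γ q : ℝ) : Submodule 𝕜 S :=
  slow F (q + γ) ⊓ ⨅ i, ⨅ _ : ‖lam i‖ < q, LinearMap.ker (LinearMap.proj i ∘ₗ F 0)

variable {F : ℕ → S →ₗ[𝕜] (ι → 𝕜)} {lam : ι → 𝕜} {γ q ε : ℝ} {y : S} {t : ℕ}

lemma mem_growthSummand :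
    y ∈ growthSummand F lam γ q ↔ y ∈ slow F (q + γ) ∧ ∀ i, ‖lam i‖ < q → F 0 y i = 0 := by
  simp [growthSummand]

variable (hγ : 0 < γ) (hF : ∀ y, IsPerturbedOrbit lam (γ / 3) fun t => F t y)

include hγ hF

lemma slow_le_growthSummand_sup_slow [ProperSpace 𝕜] {r : ℝ} (hF0 : Function.Bijective (F 0))
    (hr : γ ≤ r) (hrq : r ≤ q + γ) (hgap : HasGap lam r γ) (hlow : ∀ i, ‖lam i‖ < q → ‖lam i‖ ≤ r) :
    slow F (q + γ) ≤ growthSummand F lam γ q ⊔ slow F r := by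
  intro y hy
  obtain ⟨w, hw, hwlow⟩ := exists_mem_slow_low_eq hγ hr hgap hF hF0 (F 0 y)
  refine Submodule.mem_sup.2 ⟨y - w, mem_growthSummand.2 ⟨?_, fun i hi => ?_⟩, w, hw, by simp⟩
  · exact sub_mem hy (slow_mono (hγ.le.trans hr) hrq hw)
  · rw [map_sub, Pi.sub_apply, hwlow i (mem_low.2 (hlow i hi)), sub_self]

variable (hiso : IsIsolated lam γ q)

include hiso

lemma finrank_growthSummand [ProperSpace 𝕜] (hq : 0 ≤ q) (hF0 : Function.Bijective (F 0)) :
    Module.finrank 𝕜 (growthSummand F lam γ q) =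
      (Finset.univ.filter fun i => ‖lam i‖ = q).card := by
  have hgap := hiso.hasGap_add hγ
  let R : growthSummand F lam γ q →ₗ[𝕜] ({i // ‖lam i‖ = q} → 𝕜) :=
    LinearMap.funLeft 𝕜 𝕜 Subtype.val ∘ₗ F 0 ∘ₗ (growthSummand F lam γ q).subtype
  have hinj : Function.Injective R := by
    refine (injective_iff_map_eq_zero R).2 fun ⟨y, hy⟩ hRy => Subtype.ext ?_
    rw [mem_growthSummand] at hy
    refine eq_zero_of_mem_slow hγ (by linarith) hgap hF hF0.1 hy.1 fun i hi => ?_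
    rcases (hiso.mem_low_iff hγ).1 hi with hi | hi
    · exact congrFun hRy ⟨i, hi⟩
    · exact hy.2 i hi
  have hsurj : Function.Surjective R := by
    classical
    intro u
    obtain ⟨y, hy, hylow⟩ := exists_mem_slow_low_eq hγ (by linarith) hgap hF hF0
      fun i => if h : ‖lam i‖ = q then u ⟨i, h⟩ else 0
    refine ⟨⟨y, mem_growthSummand.2 ⟨hy, fun i hi => ?_⟩⟩, funext fun ⟨i, hi⟩ => ?_⟩
    · rw [hylow i ((hiso.mem_low_iff hγ).2 (Or.inr hi)), dif_neg hi.ne]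
    · exact (hylow i ((hiso.mem_low_iff hγ).2 (Or.inl hi))).trans (dif_pos hi)
  rw [(LinearEquiv.ofBijective R ⟨hinj, hsurj⟩).finrank_eq, Module.finrank_fintype_fun_eq_card,
    Fintype.card_subtype]

lemma norm_succ_le_of_mem_slow (hq : 0 ≤ q) (hy : y ∈ slow F (q + γ)) (hε : 0 ≤ ε)
    (h : ∀ i, ‖lam i‖ = q → ‖F (t + 1) y i - lam i * F t y i‖ ≤ ε * ‖F t y‖) :
    ‖F (t + 1) y‖ ≤ (q + ε) * ‖F t y‖ := by
  rw [norm_eq_partNorm_low_of_mem_slow hγ (by linarith) (hiso.hasGap_add hγ) hF hy (t + 1)]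
  refine partNorm_le (by positivity) fun i hi => ?_
  have hstep : ‖F (t + 1) y i‖ ≤ ‖lam i‖ * ‖F t y‖ + ‖F (t + 1) y i - lam i * F t y i‖ :=
    calc ‖F (t + 1) y i‖ ≤ ‖lam i * F t y i‖ + ‖F (t + 1) y i - lam i * F t y i‖ :=
          norm_le_norm_add_norm_sub' _ _
      _ ≤ _ := by rw [norm_mul]; gcongr; exact norm_le_pi_norm _ i
  have hN := norm_nonneg (F t y)
  rcases hiso i with hlam | hlam | hlam
  · have hsmall : ‖lam i‖ * ‖F t y‖ ≤ (q - 2 * γ) * ‖F t y‖ := by gcongr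
    have herr : ‖F (t + 1) y i - lam i * F t y i‖ ≤ γ / 3 * ‖F t y‖ := hF y t i
    nlinarith [mul_nonneg hε hN, mul_nonneg hγ.le hN]
  · rw [hlam] at hstep
    linarith [h i hlam]
  · linarith [mem_low.1 hi]

/-- The coordinates of larger eigenvalues are small because `y` is slow, those of smaller
eigenvalues because they vanish at time `0`. -/
lemma norm_le_partNorm_of_mem_growthSummand (hq : 2 * γ ≤ q) (hy : y ∈ growthSummand F lam γ q)
    (t : ℕ) : ‖F t y‖ ≤ partNorm {i | ‖lam i‖ = q} (F t y) := by
  rw [mem_growthSummand] at hy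
  have hhigh : 2 * partNorm (high lam (q + γ)) (F t y) ≤ ‖F t y‖ :=
    (two_mul_partNorm_high_le_of_mem_slow hγ (by linarith) (hiso.hasGap_add hγ) hF hy.1 t).trans
      partNorm_le_norm
  have hlow : 2 * partNorm (low lam (q - γ)) (F t y) ≤ ‖F t y‖ := by
    refine (((hF y).isDichotomy hγ (by linarith) (hiso.hasGap_sub hγ)).two_mul_low_le_high hγ
      (by linarith) ?_ t).trans partNorm_le_norm
    rw [partNorm_eq_zero fun i hi => hy.2 i (by linarith [mem_low.1 hi]), mul_zero]
    exact partNorm_nonneg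
  suffices h : ‖F t y‖ ≤ max (partNorm {i | ‖lam i‖ = q} (F t y)) (‖F t y‖ / 2) by
    rcases le_max_iff.1 h with h | h
    · exact h
    · exact le_trans (by linarith) partNorm_nonneg
  refine (pi_norm_le_iff_of_nonneg (le_max_of_le_left partNorm_nonneg)).2 fun i => ?_
  rcases hiso i with hlam | hlam | hlam
  · have hi : i ∈ low lam (q - γ) := mem_low.2 (by linarith)
    exact le_max_of_le_right (by linarith [norm_le_partNorm (v := F t y) hi])
  · exact le_max_of_le_left (norm_le_partNorm (by simpa using hlam))
  · have hi : i ∈ high lam (q + γ) := mem_high.2 (by linarith)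
    exact le_max_of_le_right (by linarith [norm_le_partNorm (v := F t y) hi])

lemma le_norm_succ_of_mem_growthSummand (hq : 2 * γ ≤ q) (hε : 0 ≤ ε)
    (hy : y ∈ growthSummand F lam γ q)
    (h : ∀ i, ‖lam i‖ = q → ‖F (t + 1) y i - lam i * F t y i‖ ≤ ε * ‖F t y‖) :
    (q - ε) * ‖F t y‖ ≤ ‖F (t + 1) y‖ := by
  have hmid := norm_le_partNorm_of_mem_growthSummand hγ hF hiso hq hy t
  have hcoord : q * partNorm {i | ‖lam i‖ = q} (F t y) ≤ ‖F (t + 1) y‖ + ε * ‖F t y‖ := by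
    refine mul_partNorm_le (by positivity) fun i hi => ?_
    have hlam : ‖lam i‖ = q := by simpa using hi
    calc q * ‖F t y i‖ = ‖lam i * F t y i‖ := by rw [norm_mul, hlam]
      _ ≤ ‖F (t + 1) y i‖ + ‖F (t + 1) y i - lam i * F t y i‖ :=
          norm_le_norm_add_norm_sub _ _
      _ ≤ _ := add_le_add (norm_le_pi_norm _ i) (h i hlam)
  nlinarith

end GrowthSummand

section Spectrum

variable {ι 𝕜 S : Type*} {s : ℕ} {γ : ℝ} {ρ : Fin (s + 1) → ℝ}

/-- The absolute values of the eigenvalues are among the nonnegative numbers `ρ 0 > … > ρ s`,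
the gaps between which are at least `2 * γ`. -/
structure IsSpectrum [NormedField 𝕜] (lam : ι → 𝕜) (γ : ℝ) (ρ : Fin (s + 1) → ℝ) : Prop where
  gap : ∀ i j, i < j → ρ j + 2 * γ ≤ ρ i
  nonneg : ∀ i, 0 ≤ ρ i
  norm_mem : ∀ i, ∃ θ, ‖lam i‖ = ρ θ

namespace IsSpectrum

lemma isIsolated [NormedField 𝕜] {lam : ι → 𝕜} (hsp : IsSpectrum lam γ ρ) (θ : Fin (s + 1)) :
    IsIsolated lam γ (ρ θ) := by
  intro i
  obtain ⟨θ', h'⟩ := hsp.norm_mem i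
  rcases lt_trichotomy θ' θ with h | rfl | h
  · right; right; linarith [hsp.gap _ _ h]
  · right; left; exact h'
  · left; linarith [hsp.gap _ _ h]

lemma strictAnti [NormedField 𝕜] {lam : ι → 𝕜} (hsp : IsSpectrum lam γ ρ) (hγ : 0 < γ) :
    StrictAnti ρ := fun i j h => by linarith [hsp.gap i j h]

lemma norm_le_succ_of_norm_lt [NormedField 𝕜] {lam : ι → 𝕜} (hsp : IsSpectrum lam γ ρ)
    (hγ : 0 < γ) {θ : Fin s} {i : ι} (h : ‖lam i‖ < ρ θ.castSucc) : ‖lam i‖ ≤ ρ θ.succ := by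
  obtain ⟨θ', h'⟩ := hsp.norm_mem i
  rw [h'] at h ⊢
  have hlt : θ.castSucc < θ' := (hsp.strictAnti hγ).lt_iff_gt.1 h
  exact (hsp.strictAnti hγ).antitone (Fin.castSucc_lt_iff_succ_le.1 hlt)

variable [Fintype ι] [NontriviallyNormedField 𝕜] [AddCommGroup S] [Module 𝕜 S]
  {F : ℕ → S →ₗ[𝕜] (ι → 𝕜)} {lam : ι → 𝕜} (hsp : IsSpectrum lam γ ρ) (hγ : 0 < γ)
  (hF : ∀ y, IsPerturbedOrbit lam (γ / 3) fun t => F t y)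

include hsp hγ hF

lemma norm_le_of_mem_slow {θ : Fin (s + 1)} {y : S} (hy : y ∈ slow F (ρ θ + γ)) (t : ℕ) :
    ‖F t y‖ ≤ ‖F 0 y‖ * (ρ θ + γ) ^ t := by
  have hr : γ ≤ ρ θ + γ := by linarith [hsp.nonneg θ]
  have hgap := (hsp.isIsolated θ).hasGap_add hγ
  exact norm_le_norm_zero_mul_pow hγ hr hgap hF
    (two_mul_partNorm_high_le_of_mem_slow hγ hr hgap hF hy) t

lemma norm_le_norm_add {θ : Fin s} {v w : S} (hv : v ∈ growthSummand F lam γ (ρ θ.castSucc))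
    (hw : w ∈ slow F (ρ θ.succ + γ)) : ‖F 0 w‖ ≤ ‖F 0 (v + w)‖ := by
  have hr : γ ≤ ρ θ.succ + γ := by linarith [hsp.nonneg θ.succ]
  rw [norm_eq_partNorm_low_of_mem_slow hγ hr ((hsp.isIsolated θ.succ).hasGap_add hγ) hF hw 0]
  refine partNorm_le (norm_nonneg _) fun i hi => ?_
  have hlt : ‖lam i‖ < ρ θ.castSucc := by
    linarith [hsp.gap _ _ (Fin.castSucc_lt_succ (i := θ)), mem_low.1 hi]
  have hcoord : F 0 (v + w) i = F 0 w i := by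
    rw [map_add, Pi.add_apply, (mem_growthSummand.1 hv).2 i hlt, zero_add]
  exact hcoord ▸ norm_le_pi_norm (F 0 (v + w)) i

variable [ProperSpace 𝕜] (hF0 : Function.Bijective (F 0))

include hF0

lemma slow_le_iSup_growthSummand (θ : Fin (s + 1)) :
    slow F (ρ θ + γ) ≤ ⨆ i, growthSummand F lam γ (ρ i) := by
  induction θ using Fin.reverseInduction with
  | last =>
    refine le_trans ?_ (le_iSup (fun i => growthSummand F lam γ (ρ i)) (Fin.last s))
    refine fun y hy => mem_growthSummand.2 ⟨hy, fun i hi => ?_⟩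
    obtain ⟨θ, h⟩ := hsp.norm_mem i
    exact absurd hi (h ▸ ((hsp.strictAnti hγ).antitone (Fin.le_last θ)).not_gt)
  | cast θ ih =>
    have hsplit : slow F (ρ θ.castSucc + γ) ≤
        growthSummand F lam γ (ρ θ.castSucc) ⊔ slow F (ρ θ.succ + γ) :=
      slow_le_growthSummand_sup_slow hγ hF hF0 (by linarith [hsp.nonneg θ.succ])
        (by linarith [hsp.gap _ _ (Fin.castSucc_lt_succ (i := θ))])
        ((hsp.isIsolated _).hasGap_add hγ)
        (fun i hi => by linarith [hsp.norm_le_succ_of_norm_lt hγ hi])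
    exact hsplit.trans (sup_le (le_iSup (fun i => growthSummand F lam γ (ρ i)) θ.castSucc) ih)

lemma iSup_growthSummand_eq_top : ⨆ i, growthSummand F lam γ (ρ i) = ⊤ := by
  refine eq_top_iff.2 fun y _ => hsp.slow_le_iSup_growthSummand hγ hF hF0 0 ?_
  obtain ⟨w, hw, hwlow⟩ := exists_mem_slow_low_eq hγ (by linarith [hsp.nonneg 0])
    ((hsp.isIsolated 0).hasGap_add hγ) hF hF0 (F 0 y)
  suffices h : w = y from h ▸ hw
  refine hF0.1 (funext fun i => hwlow i (mem_low.2 ?_))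
  obtain ⟨θ, h⟩ := hsp.norm_mem i
  linarith [(hsp.strictAnti hγ).antitone (Fin.zero_le θ)]

lemma sum_finrank_growthSummand :
    ∑ θ, Module.finrank 𝕜 (growthSummand F lam γ (ρ θ)) = Fintype.card ι := by
  simp_rw [fun θ => finrank_growthSummand hγ hF (hsp.isIsolated θ) (hsp.nonneg θ) hF0]
  choose f hf using hsp.norm_mem
  rw [← Finset.card_univ, Finset.card_eq_sum_card_fiberwise (f := f) (t := Finset.univ) (by simp)]
  refine Finset.sum_congr rfl fun θ _ => congrArg Finset.card (Finset.filter_congr fun i _ => ?_)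
  rw [hf, (hsp.strictAnti hγ).injective.eq_iff]

lemma isInternal : DirectSum.IsInternal fun i => growthSummand F lam γ (ρ i) := by
  have hsurj : Function.Surjective
      (DirectSum.coeLinearMap fun i => growthSummand F lam γ (ρ i)) := by
    rw [← LinearMap.range_eq_top, DirectSum.range_coeLinearMap]
    exact hsp.iSup_growthSummand_eq_top hγ hF hF0
  let e : S ≃ₗ[𝕜] (ι → 𝕜) := LinearEquiv.ofBijective (F 0) hF0
  have := e.symm.finiteDimensional
  have hdim : Module.finrank 𝕜 (DirectSum _ fun i => growthSummand F lam γ (ρ i)) =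
      Module.finrank 𝕜 S := by
    rw [Module.finrank_directSum, hsp.sum_finrank_growthSummand hγ hF hF0, e.finrank_eq,
      Module.finrank_fintype_fun_eq_card]
  exact ⟨(LinearMap.injective_iff_surjective_of_finrank_eq_finrank hdim).2 hsurj, hsurj⟩

end IsSpectrum

end Spectrum

section Projection

variable {s : ℕ} {M : Type*} [AddCommGroup M] [Module ℂ M]
  {V : Fin (s + 1) → Submodule ℂ M} (h : DirectSum.IsInternal V)

include h

lemma sum_proj (y : M) : ∑ i, (proj h i y : M) = y := by
  classical
  have hbij : Function.Bijective (DirectSum.coeLinearMap V) := h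
  have key := (LinearEquiv.ofBijective (DirectSum.coeLinearMap V) hbij).apply_symm_apply y
  rw [LinearEquiv.ofBijective_apply, DirectSum.coeLinearMap_eq_dfinsuppSum,
    DFinsupp.sum_eq_sum_fintype _ (fun _ => by simp)] at key
  exact key

lemma proj_eq_zero_of_mem {i j : Fin (s + 1)} (hij : i ≠ j) {y : M} (hy : y ∈ V i) :
    proj h j y = 0 :=
  h.ofBijective_coeLinearMap_of_mem_ne hij hy

lemma proj_eq_zero_of_mem_upperSum {i j : Fin (s + 1)} (hij : i < j) {y : M}
    (hy : y ∈ upperSum V j) : proj h i y = 0 := by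
  have hle : upperSum V j ≤ LinearMap.ker (proj h i) :=
    iSup₂_le fun k hk z hz => proj_eq_zero_of_mem h (hij.trans_le hk).ne' hz
  exact hle hy

lemma proj_eq_zero_of_mem_lowerSum {i j : Fin (s + 1)} (hij : j < i) {y : M}
    (hy : y ∈ lowerSum V j) : proj h i y = 0 := by
  have hle : lowerSum V j ≤ LinearMap.ker (proj h i) :=
    iSup₂_le fun k hk z hz => proj_eq_zero_of_mem h (hk.trans_lt hij).ne hz
  exact hle hy

lemma sum_proj_of_mem_lowerSum {j : Fin (s + 1)} {y : M} (hy : y ∈ lowerSum V j) :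
    ∑ i ∈ Finset.Iic j, (proj h i y : M) = y := by
  refine (Finset.sum_subset (Finset.subset_univ _) fun i _ hi => ?_).trans (sum_proj h y)
  rw [Finset.mem_Iic, not_le] at hi
  rw [proj_eq_zero_of_mem_lowerSum h hi hy, ZeroMemClass.coe_zero]

lemma sub_proj_mem_of_mem_upperSum {W : Submodule ℂ M} {j : Fin (s + 1)}
    (hW : ∀ i, j < i → V i ≤ W) {y : M} (hy : y ∈ upperSum V j) : y - proj h j y ∈ W := by
  have hsum : y - proj h j y = ∑ i ∈ Finset.univ.erase j, (proj h i y : M) := by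
    rw [sub_eq_iff_eq_add, Finset.sum_erase_add _ _ (Finset.mem_univ j), sum_proj h]
  rw [hsum]
  refine Submodule.sum_mem _ fun i hi => ?_
  rcases lt_or_gt_of_ne (Finset.ne_of_mem_erase hi) with hij | hij
  · simp [proj_eq_zero_of_mem_upperSum h hij hy]
  · exact hW i hij (proj h i y).2

end Projection

section Rate

variable {k ν : ℕ}

/-- The order of magnitude of the increments of `rate k`, and of the perturbation of the weighted
coordinates belonging to roots of maximal multiplicity `k`. -/
noncomputable def rateStep (k ν : ℕ) : ℝ := (ν : ℝ) ^ (-(1 / (k : ℝ)))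

lemma rateStep_nonneg (k ν : ℕ) : 0 ≤ rateStep k ν := by
  rw [rateStep]
  positivity

lemma inv_le_rateStep (k : ℕ) (hν : 1 ≤ ν) : (ν : ℝ)⁻¹ ≤ rateStep k ν := by
  rw [← Real.rpow_neg_one, rateStep]
  refine Real.rpow_le_rpow_of_exponent_le (by exact_mod_cast hν) (neg_le_neg ?_)
  exact sub_nonneg.1 (Nat.one_sub_one_div_cast_nonneg k)

lemma tendsto_rateStep (hk : 1 ≤ k) : Tendsto (rateStep k) atTop (𝓝 0) :=
  (tendsto_rpow_neg_atTop (by positivity)).comp tendsto_natCast_atTop_atTop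

lemma one_le_rate (k : ℕ) (hν : 1 ≤ ν) : 1 ≤ rate k ν := by
  have hν' : (1 : ℝ) ≤ ν := by exact_mod_cast hν
  have hpow := Real.one_le_rpow hν' (Nat.one_sub_one_div_cast_nonneg k)
  rw [rate]
  linarith [Real.log_nonneg hν']

lemma log_le_rate (k ν : ℕ) : Real.log ν ≤ rate k ν :=
  le_add_of_nonneg_right (by positivity)

lemma rate_mono {k' : ℕ} (hk : 1 ≤ k) (hkk' : k ≤ k') (hν : 1 ≤ ν) : rate k ν ≤ rate k' ν := by
  have hk0 : (0 : ℝ) < k := by exact_mod_cast hk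
  have hle : (k : ℝ) ≤ k' := by exact_mod_cast hkk'
  exact add_le_add_right (Real.rpow_le_rpow_of_exponent_le (by exact_mod_cast hν)
    (sub_le_sub_left (one_div_le_one_div_of_le hk0 hle) 1)) _

lemma rate_le_mul (k : ℕ) {ν' : ℕ} {c : ℝ} (hν : 1 ≤ ν) (hν' : 1 ≤ ν') (hc : 1 ≤ c)
    (h : (ν' : ℝ) ≤ c * ν) : rate k ν' ≤ 2 * c * rate k ν := by
  have hνr : (1 : ℝ) ≤ ν := by exact_mod_cast hν
  have hν'r : (1 : ℝ) ≤ ν' := by exact_mod_cast hν'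
  have hβ := Nat.one_sub_one_div_cast_nonneg (α := ℝ) k
  have hlog : Real.log ν' ≤ c + Real.log ν := by
    have hmono := Real.log_le_log (by linarith) h
    rw [Real.log_mul (by linarith) (by linarith)] at hmono
    linarith [Real.log_le_sub_one_of_pos (show (0 : ℝ) < c by linarith)]
  have hpow : (ν' : ℝ) ^ (1 - 1 / (k : ℝ)) ≤ c * (ν : ℝ) ^ (1 - 1 / (k : ℝ)) :=
    calc (ν' : ℝ) ^ (1 - 1 / (k : ℝ))
        ≤ (c * ν) ^ (1 - 1 / (k : ℝ)) := Real.rpow_le_rpow (by linarith) h hβ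
      _ = c ^ (1 - 1 / (k : ℝ)) * (ν : ℝ) ^ (1 - 1 / (k : ℝ)) :=
          Real.mul_rpow (by linarith) (by linarith)
      _ ≤ c * (ν : ℝ) ^ (1 - 1 / (k : ℝ)) := by
          gcongr
          exact Real.rpow_le_self_of_one_le hc (sub_le_self _ (by positivity))
  have hone := one_le_rate k hν
  have hlog0 := Real.log_nonneg hνr
  have hpow0 : 0 ≤ (ν : ℝ) ^ (1 - 1 / (k : ℝ)) := by positivity
  rw [rate] at hone ⊢
  rw [rate]
  nlinarith

lemma inv_add_one_le_log_sub {x : ℝ} (hx : 0 < x) :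
    (x + 1)⁻¹ ≤ Real.log (x + 1) - Real.log x := by
  have h := Real.one_sub_inv_le_log_of_pos (show 0 < (x + 1) / x by positivity)
  rw [Real.log_div (by positivity) hx.ne', inv_div] at h
  refine le_trans (le_of_eq ?_) h
  field_simp
  ring

lemma rpow_one_sub_add_le {x κ : ℝ} (hx : 0 < x) (hκ0 : 0 ≤ κ) (hκ1 : κ ≤ 1) :
    x ^ (1 - κ) + (1 - κ) * (x + 1) ^ (-κ) ≤ (x + 1) ^ (1 - κ) := by
  have hbern := rpow_one_add_le_one_add_mul_self (s := -(1 / (x + 1)))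
    (by rw [neg_le_neg_iff, div_le_one (by positivity)]; linarith)
    (sub_nonneg.2 hκ1) (by linarith)
  have hquot : 1 + -(1 / (x + 1)) = x / (x + 1) := by field_simp; ring
  rw [hquot, Real.div_rpow hx.le (by positivity), div_le_iff₀ (by positivity)] at hbern
  have hshift : (x + 1) ^ (1 - κ) * (1 / (x + 1)) = (x + 1) ^ (-κ) := by
    rw [show -κ = (1 - κ) - 1 by ring, Real.rpow_sub_one (by positivity)]
    ring
  linear_combination hbern - (1 - κ) * hshift

lemma half_mul_rpow_neg_le {x κ : ℝ} (hx : 1 ≤ x) (hκ0 : 0 ≤ κ) (hκ1 : κ ≤ 1) :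
    1 / 2 * x ^ (-κ) ≤ (x + 1) ^ (-κ) :=
  calc 1 / 2 * x ^ (-κ) = 2 ^ (-1 : ℝ) * x ^ (-κ) := by rw [Real.rpow_neg_one, one_div]
    _ ≤ 2 ^ (-κ) * x ^ (-κ) := by
        gcongr
        exact one_le_two
    _ = (2 * x) ^ (-κ) := (Real.mul_rpow (by norm_num) (by linarith)).symm
    _ ≤ (x + 1) ^ (-κ) :=
        Real.rpow_le_rpow_of_nonpos (by positivity) (by linarith) (by linarith)

-- The logarithm carries the increment for `k = 1`, the power for `k ≥ 2`.
lemma rate_succ (hk : 1 ≤ k) (hν : 1 ≤ ν) :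
    rate k ν + 1 / 4 * rateStep k ν ≤ rate k (ν + 1) := by
  have hνr : (1 : ℝ) ≤ ν := by exact_mod_cast hν
  have hν0 : (0 : ℝ) < ν := by linarith
  have hκ0 : 0 ≤ 1 / (k : ℝ) := by positivity
  have hhalf := half_mul_rpow_neg_le hνr hκ0 (sub_nonneg.1 (Nat.one_sub_one_div_cast_nonneg k))
  have hlog := inv_add_one_le_log_sub hν0
  rcases hk.eq_or_lt with rfl | hk2
  · norm_num [rate, rateStep, Real.rpow_neg_one] at hhalf hlog ⊢
    linarith [inv_nonneg.2 hν0.le]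
  · have hκ : 1 / (k : ℝ) ≤ 1 / 2 :=
      one_div_le_one_div_of_le (by norm_num) (by exact_mod_cast hk2)
    have hpow := rpow_one_sub_add_le hν0 hκ0 (by linarith)
    have hcoef : 1 / 2 * ((ν : ℝ) + 1) ^ (-(1 / (k : ℝ))) ≤
        (1 - 1 / (k : ℝ)) * (ν + 1) ^ (-(1 / (k : ℝ))) := by
      gcongr
      linarith
    have hinv : (0 : ℝ) ≤ ((ν : ℝ) + 1)⁻¹ := by positivity
    simp only [rate, rateStep, Nat.cast_add, Nat.cast_one]
    linarith

lemma tendsto_rate_div (hk : 1 ≤ k) : Tendsto (fun ν : ℕ => rate k ν / ν) atTop (𝓝 0) := by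
  have hlog : Tendsto (fun ν : ℕ => Real.log ν / ν) atTop (𝓝 0) :=
    Real.isLittleO_log_id_atTop.tendsto_div_nhds_zero.comp tendsto_natCast_atTop_atTop
  rw [← add_zero (0 : ℝ)]
  refine (hlog.add (tendsto_rateStep hk)).congr' ?_
  filter_upwards [eventually_ge_atTop 1] with ν hν
  have hν0 : (ν : ℝ) ≠ 0 := by positivity
  rw [rate, rateStep, add_div, show -(1 / (k : ℝ)) = (1 - 1 / (k : ℝ)) - 1 by ring,
    Real.rpow_sub_one hν0]

lemma tendsto_pow_mul_exp_rate (hk : 1 ≤ k) {c : ℝ} (hc : 0 < c) (hc1 : c < 1) (B : ℝ) :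
    Tendsto (fun ν : ℕ => c ^ ν * Real.exp (B * rate k ν)) atTop (𝓝 0) := by
  have hslope : Tendsto (fun ν : ℕ => Real.log c + B * (rate k ν / ν)) atTop
      (𝓝 (Real.log c)) := by
    simpa using ((tendsto_rate_div hk).const_mul B).const_add (Real.log c)
  have hexponent := (tendsto_natCast_atTop_atTop (R := ℝ)).atTop_mul_neg
    (Real.log_neg hc hc1) hslope
  refine (Real.tendsto_exp_atBot.comp hexponent).congr' ?_
  filter_upwards [eventually_ge_atTop 1] with ν hν
  have hν0 : (ν : ℝ) ≠ 0 := by positivity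
  rw [Function.comp_apply, mul_add, Real.exp_add, ← Real.rpow_natCast, Real.rpow_def_of_pos hc,
    mul_comm (ν : ℝ) (Real.log c)]
  congr 2
  field_simp

lemma exp_neg_two_mul_le {x : ℝ} (hx0 : 0 ≤ x) (hx1 : x ≤ 1 / 2) :
    Real.exp (-(2 * x)) ≤ 1 - x := by
  rw [Real.exp_neg, inv_le_comm₀ (Real.exp_pos _) (by linarith)]
  refine le_trans ?_ (Real.add_one_le_exp (2 * x))
  rw [inv_le_iff_one_le_mul₀ (by linarith)]
  nlinarith

variable {m : ℕ} {N : ℕ → ℝ} {q C : ℝ}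

lemma mul_rateStep_add_mul_rate_le (hk : 1 ≤ k) (hν : 1 ≤ ν) (hC : 0 ≤ C) :
    C * rateStep k ν + 4 * C * rate k ν ≤ 4 * C * rate k (ν + 1) := by
  linear_combination mul_le_mul_of_nonneg_left (rate_succ hk hν) (show 0 ≤ 4 * C by positivity)

lemma le_pow_mul_exp_rate (hk : 1 ≤ k) (hm : 1 ≤ m) (hN : ∀ t, 0 ≤ N t) (hq : 0 < q) (hC : 0 ≤ C)
    (h : ∀ t, N (t + 1) ≤ (q + C * rateStep k (m + t)) * N t) (t : ℕ) :
    N t ≤ q ^ t * Real.exp (4 * (C / q) * rate k (m + t)) * N 0 := by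
  induction t with
  | zero =>
    have hexp : 1 ≤ Real.exp (4 * (C / q) * rate k (m + 0)) := by
      have := one_le_rate (ν := m + 0) k hm
      exact Real.one_le_exp (by positivity)
    simpa using le_mul_of_one_le_left (hN 0) hexp
  | succ t ih =>
    have hstep := mul_rateStep_add_mul_rate_le (ν := m + t) hk (by lia)
      (show 0 ≤ C / q by positivity)
    have hN0 := hN 0
    specialize h t
    have hε := rateStep_nonneg k (m + t)
    set ε := rateStep k (m + t)
    have hfactor : q + C * ε ≤ q * Real.exp (C / q * ε) :=
      calc q + C * ε = q * (C / q * ε + 1) := by field_simp; ring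
        _ ≤ q * Real.exp (C / q * ε) := by gcongr; exact Real.add_one_le_exp _
    calc N (t + 1) ≤ (q + C * ε) * N t := h
      _ ≤ (q * Real.exp (C / q * ε)) *
            (q ^ t * Real.exp (4 * (C / q) * rate k (m + t)) * N 0) :=
          mul_le_mul hfactor ih (hN t) (by positivity)
      _ = q ^ (t + 1) * Real.exp (C / q * ε + 4 * (C / q) * rate k (m + t)) * N 0 := by
          rw [Real.exp_add]; ring
      _ ≤ q ^ (t + 1) * Real.exp (4 * (C / q) * rate k (m + (t + 1))) * N 0 := by
          gcongr
          exact hstep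

lemma pow_mul_exp_rate_le (hk : 1 ≤ k) (hm : 1 ≤ m) (hN : ∀ t, 0 ≤ N t) (hq : 0 < q) (hC : 0 ≤ C)
    (hsmall : ∀ t, C * rateStep k (m + t) ≤ q / 2)
    (h : ∀ t, (q - C * rateStep k (m + t)) * N t ≤ N (t + 1)) (t : ℕ) :
    q ^ t * Real.exp (-(4 * (2 * (C / q)) * rate k (m + t))) * N 0 ≤ N t := by
  induction t with
  | zero =>
    have hexp : Real.exp (-(4 * (2 * (C / q)) * rate k (m + 0))) ≤ 1 := by
      have := one_le_rate (ν := m + 0) k hm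
      exact Real.exp_le_one_iff.2 (neg_nonpos.2 (by positivity))
    simpa using mul_le_of_le_one_left (hN 0) hexp
  | succ t ih =>
    have hstep := mul_rateStep_add_mul_rate_le (ν := m + t) hk (by lia)
      (show 0 ≤ 2 * (C / q) by positivity)
    have hN0 := hN 0
    specialize h t
    specialize hsmall t
    have hε := rateStep_nonneg k (m + t)
    set ε := rateStep k (m + t)
    have hfactor : q * Real.exp (-(2 * (C / q * ε))) ≤ q - C * ε :=
      calc q * Real.exp (-(2 * (C / q * ε))) ≤ q * (1 - C / q * ε) := by
            gcongr
            refine exp_neg_two_mul_le (by positivity) ?_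
            rw [div_mul_eq_mul_div, div_le_iff₀ hq]
            linarith
        _ = q - C * ε := by field_simp
    calc q ^ (t + 1) * Real.exp (-(4 * (2 * (C / q)) * rate k (m + (t + 1)))) * N 0
        ≤ q ^ (t + 1) *
            Real.exp (-(2 * (C / q * ε)) + -(4 * (2 * (C / q)) * rate k (m + t))) * N 0 := by
          gcongr
          linear_combination hstep
      _ = (q * Real.exp (-(2 * (C / q * ε)))) *
            (q ^ t * Real.exp (-(4 * (2 * (C / q)) * rate k (m + t))) * N 0) := by
          rw [Real.exp_add]; ring
      _ ≤ (q - C * ε) * N t :=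
          mul_le_mul hfactor ih (by positivity) (le_trans (by positivity) hfactor)
      _ ≤ N (t + 1) := h

lemma pow_self_le_exp_mul_factorial_pred (hν : 1 ≤ ν) :
    (ν : ℝ) ^ ν ≤ Real.exp (2 * ν) * ((ν - 1).factorial : ℝ) :=
  calc (ν : ℝ) ^ ν ≤ Real.exp ν * ν.factorial :=
        (div_le_iff₀ (by positivity)).1 (Real.pow_div_factorial_le_exp _ (by positivity) _)
    _ = Real.exp ν * (ν * (ν - 1).factorial) := by
        rw [← Nat.mul_factorial_pred (by lia), Nat.cast_mul]
    _ ≤ Real.exp ν * (Real.exp ν * (ν - 1).factorial) := by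
        gcongr
        linarith [Real.add_one_le_exp (ν : ℝ)]
    _ = Real.exp (2 * ν) * ((ν - 1).factorial : ℝ) := by rw [two_mul, Real.exp_add, mul_assoc]

lemma rpow_div_le_exp_mul_factorial_pred (k : ℕ) (hν : 1 ≤ ν) :
    (ν : ℝ) ^ ((ν : ℝ) / k) ≤ Real.exp (2 * ν) * ((ν - 1).factorial : ℝ) ^ (1 / (k : ℝ)) :=
  calc (ν : ℝ) ^ ((ν : ℝ) / k) = ((ν : ℝ) ^ ν) ^ (1 / (k : ℝ)) := by
        rw [← Real.rpow_natCast_mul (by positivity), mul_one_div]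
    _ ≤ (Real.exp (2 * ν) * ((ν - 1).factorial : ℝ)) ^ (1 / (k : ℝ)) :=
        Real.rpow_le_rpow (by positivity) (pow_self_le_exp_mul_factorial_pred hν) (by positivity)
    _ = Real.exp (2 * ν) ^ (1 / (k : ℝ)) * ((ν - 1).factorial : ℝ) ^ (1 / (k : ℝ)) :=
        Real.mul_rpow (by positivity) (by positivity)
    _ ≤ Real.exp (2 * ν) * ((ν - 1).factorial : ℝ) ^ (1 / (k : ℝ)) := by
        gcongr
        exact Real.rpow_le_self_of_one_le (Real.one_le_exp (by positivity))
          (sub_nonneg.1 (Nat.one_sub_one_div_cast_nonneg k))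

lemma mul_factorial_rpow_le {κ : ℝ} (hm : 1 ≤ m) (hC : 0 ≤ C)
    (h : ∀ t, N (t + 1) ≤ C * ((m + t : ℕ) : ℝ) ^ (-κ) * N t) (t : ℕ) :
    N t * ((m + t - 1).factorial : ℝ) ^ κ ≤ C ^ t * (N 0 * ((m - 1).factorial : ℝ) ^ κ) := by
  induction t with
  | zero => simp
  | succ t ih =>
    have hpos : (0 : ℝ) < ((m + t : ℕ) : ℝ) := by exact_mod_cast (by lia : 0 < m + t)
    have hfact : (m + (t + 1) - 1).factorial = (m + t) * (m + t - 1).factorial :=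
      (Nat.mul_factorial_pred (by lia)).symm
    rw [hfact, Nat.cast_mul, Real.mul_rpow hpos.le (by positivity)]
    calc N (t + 1) * (((m + t : ℕ) : ℝ) ^ κ * ((m + t - 1).factorial : ℝ) ^ κ)
        ≤ C * ((m + t : ℕ) : ℝ) ^ (-κ) * N t *
            (((m + t : ℕ) : ℝ) ^ κ * ((m + t - 1).factorial : ℝ) ^ κ) := by
          gcongr
          exact h t
      _ = C * (N t * ((m + t - 1).factorial : ℝ) ^ κ) *
            (((m + t : ℕ) : ℝ) ^ (-κ) * ((m + t : ℕ) : ℝ) ^ κ) := by ring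
      _ = C * (N t * ((m + t - 1).factorial : ℝ) ^ κ) := by
          rw [← Real.rpow_add hpos, neg_add_cancel, Real.rpow_zero, mul_one]
      _ ≤ C * (C ^ t * (N 0 * ((m - 1).factorial : ℝ) ^ κ)) := by gcongr
      _ = C ^ (t + 1) * (N 0 * ((m - 1).factorial : ℝ) ^ κ) := by ring

lemma exists_superexponential_decay (k : ℕ) (hm : 1 ≤ m) (hC : 1 ≤ C) :
    ∃ B : ℝ, 0 < B ∧ ∀ N : ℕ → ℝ, (∀ t, 0 ≤ N t) →
      (∀ t, N (t + 1) ≤ C * rateStep k (m + t) * N t) →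
      ∀ t, N t ≤ B ^ (m + t) * ((m + t : ℕ) : ℝ) ^ (-(((m + t : ℕ) : ℝ) / k)) * N 0 := by
  set D : ℝ := ((m - 1).factorial : ℝ) ^ (1 / (k : ℝ))
  have hD : 1 ≤ D :=
    Real.one_le_rpow (by exact_mod_cast Nat.factorial_pos _) (by positivity)
  refine ⟨D * C * Real.exp 2, by positivity, fun N hN h t => ?_⟩
  have hfact := mul_factorial_rpow_le hm (by linarith) h t
  obtain ⟨ν, hν⟩ : ∃ ν, ν = m + t := ⟨_, rfl⟩
  rw [← hν] at hfact ⊢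
  have hν1 : 1 ≤ ν := by lia
  have hN0 := hN 0
  have hNt := hN t
  rw [Real.rpow_neg (by positivity), mul_right_comm, ← div_eq_mul_inv,
    le_div_iff₀ (by positivity)]
  calc N t * (ν : ℝ) ^ ((ν : ℝ) / k)
      ≤ N t * (Real.exp (2 * ν) * ((ν - 1).factorial : ℝ) ^ (1 / (k : ℝ))) := by
        gcongr
        exact rpow_div_le_exp_mul_factorial_pred k hν1
    _ = Real.exp (2 * ν) * (N t * ((ν - 1).factorial : ℝ) ^ (1 / (k : ℝ))) := by ring
    _ ≤ Real.exp (2 * ν) * (C ^ t * (N 0 * D)) := by gcongr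
    _ ≤ Real.exp (2 * ν) * (C ^ ν * (N 0 * D ^ ν)) := by
        gcongr ?_ * (?_ * (?_ * ?_))
        · exact pow_le_pow_right₀ hC (by lia)
        · exact le_self_pow₀ hD (by lia)
    _ = (D * C * Real.exp 2) ^ ν * N 0 := by
        rw [mul_pow, mul_pow, ← Real.exp_nat_mul, mul_comm 2 (ν : ℝ)]; ring

end Rate

section Window

variable {n m : ℕ}

lemma coe_shift (ν : Set.Ici m) (j : ℕ) : ((shift ν j : Set.Ici m) : ℕ) = ν + j := rfl

lemma coe_shift_start (m t : ℕ) : ((shift (start m) t : Set.Ici m) : ℕ) = m + t := rfl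

lemma shift_shift (ν : Set.Ici m) (i j : ℕ) : shift (shift ν i) j = shift ν (i + j) :=
  Subtype.ext (Nat.add_assoc _ _ _)

lemma shift_zero (ν : Set.Ici m) : shift ν 0 = ν := rfl

lemma exists_eq_shift_start (ν : Set.Ici m) : ∃ t, ν = shift (start m) t :=
  ⟨(ν : ℕ) - m, Subtype.ext (Nat.add_sub_cancel' ν.2).symm⟩

lemma omega_nonneg (y : Set.Ici m → ℂ) (ν : Set.Ici m) : 0 ≤ omega n y ν := norm_nonneg _

lemma norm_le_omega (y : Set.Ici m → ℂ) (ν : Set.Ici m) {j : ℕ} (hj : j < n) :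
    ‖y (shift ν j)‖ ≤ omega n y ν :=
  norm_le_pi_norm (fun j : Fin n => y (shift ν j)) ⟨j, hj⟩

lemma omega_le {y : Set.Ici m → ℂ} {ν : Set.Ici m} {c : ℝ} (hc : 0 ≤ c)
    (h : ∀ j < n, ‖y (shift ν j)‖ ≤ c) : omega n y ν ≤ c :=
  (pi_norm_le_iff_of_nonneg hc).2 fun j => h j j.2

lemma omega_zero (ν : Set.Ici m) : omega n (0 : Set.Ici m → ℂ) ν = 0 := norm_zero

lemma omega_add_le (y z : Set.Ici m → ℂ) (ν : Set.Ici m) :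
    omega n (y + z) ν ≤ omega n y ν + omega n z ν :=
  norm_add_le (fun j : Fin n => y (shift ν j)) fun j : Fin n => z (shift ν j)

lemma omega_sub_le (y z : Set.Ici m → ℂ) (ν : Set.Ici m) :
    omega n (y - z) ν ≤ omega n y ν + omega n z ν :=
  norm_sub_le (fun j : Fin n => y (shift ν j)) fun j : Fin n => z (shift ν j)

lemma omega_sum_le {κ : Type*} (s : Finset κ) (y : κ → Set.Ici m → ℂ) (ν : Set.Ici m) :
    omega n (∑ i ∈ s, y i) ν ≤ ∑ i ∈ s, omega n (y i) ν :=
  Finset.le_sum_of_subadditive (fun y : Set.Ici m → ℂ => omega n y ν) (omega_zero ν).le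
    (fun _ _ => omega_add_le _ _ _) s y

/-- The initial values `y(m), …, y(m+n-1)` of a solution. -/
def window (n : ℕ) (a : ℕ → ℕ → ℂ) (m : ℕ) : solutionSpace n a m →ₗ[ℂ] (Fin n → ℂ) :=
  LinearMap.funLeft ℂ ℂ (fun j : Fin n => shift (start m) j) ∘ₗ (solutionSpace n a m).subtype

/-- The values `y(m), y(m+1), …` of the solution with given initial values. -/
noncomputable def extend (n : ℕ) (a : ℕ → ℕ → ℂ) (m : ℕ) (u : Fin n → ℂ) : ℕ → ℂ
  | t => if h : t < n then u ⟨t, h⟩ else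
      -∑ k : Fin n, a k (m + (t - n)) * extend n a m u (t - n + k)
  decreasing_by omega

variable {a : ℕ → ℕ → ℂ} (ha_lead : ∀ ν : ℕ, a n ν = 1)

include ha_lead

lemma solution_apply_add {y : Set.Ici m → ℂ} (hy : y ∈ solutionSpace n a m) (ν : Set.Ici m) :
    y (shift ν n) = -∑ k ∈ Finset.range n, a k ν * y (shift ν k) := by
  have := hy ν
  rw [Finset.sum_range_succ, ha_lead, one_mul] at this
  exact eq_neg_of_add_eq_zero_right this

lemma window_injective : Function.Injective (window n a m) := by
  rw [← LinearMap.ker_eq_bot, LinearMap.ker_eq_bot']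
  intro y hy
  have apply_shift_start : ∀ t, (y : Set.Ici m → ℂ) (shift (start m) t) = 0 := by
    intro t
    induction t using Nat.strong_induction_on with
    | _ t ih =>
      rcases lt_or_ge t n with h | h
      · exact congrFun hy ⟨t, h⟩
      · obtain ⟨k, rfl⟩ := Nat.exists_eq_add_of_le' h
        rw [← shift_shift, solution_apply_add ha_lead y.2, neg_eq_zero]
        refine Finset.sum_eq_zero fun i hi => ?_
        rw [shift_shift, ih _ (by have := Finset.mem_range.1 hi; omega), mul_zero]
  refine Subtype.ext (funext fun ν => ?_)
  obtain ⟨t, rfl⟩ := exists_eq_shift_start ν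
  exact apply_shift_start t

lemma window_surjective : Function.Surjective (window n a m) := by
  intro u
  refine ⟨⟨fun ν => extend n a m u ((ν : ℕ) - m), fun ν => ?_⟩, funext fun j => ?_⟩
  · obtain ⟨t, rfl⟩ := exists_eq_shift_start ν
    have extend_shift : ∀ k, extend n a m u (((shift (shift (start m) t) k : Set.Ici m) : ℕ) - m) =
        extend n a m u (t + k) := by
      intro k
      rw [shift_shift, coe_shift_start, Nat.add_sub_cancel_left]
    simp only [extend_shift]
    rw [Finset.sum_range_succ, ha_lead, one_mul, coe_shift_start]
    conv_lhs => arg 2; rw [extend]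
    rw [dif_neg (by omega), Nat.add_sub_cancel, Finset.sum_range]
    exact add_neg_cancel _
  · change extend n a m u (((shift (start m) j : Set.Ici m) : ℕ) - m) = u j
    rw [coe_shift_start, Nat.add_sub_cancel_left, extend, dif_pos j.2]

lemma finiteDimensional_solutionSpace : FiniteDimensional ℂ (solutionSpace n a m) :=
  FiniteDimensional.of_injective (window n a m) (window_injective ha_lead)

lemma finrank_solutionSpace : Module.finrank ℂ (solutionSpace n a m) = n := by
  rw [(LinearEquiv.ofBijective (window n a m)
    ⟨window_injective ha_lead, window_surjective ha_lead⟩).finrank_eq, Module.finrank_fin_fun]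

end Window

section CharPol

variable {n : ℕ} {aLim : ℕ → ℂ}

lemma coeff_charPol {k : ℕ} (hk : k ≤ n) : (charPol n aLim).coeff k = aLim k := by
  simp [charPol, finsetSum_coeff, coeff_X_pow, Nat.lt_succ_iff.2 hk]

lemma natDegree_charPol_le : (charPol n aLim).natDegree ≤ n :=
  natDegree_sum_le_of_forall_le _ _ fun _ hi =>
    (natDegree_C_mul_X_pow_le _ _).trans (Nat.lt_succ_iff.1 (Finset.mem_range.1 hi))

lemma natDegree_charPol (h : aLim n = 1) : (charPol n aLim).natDegree = n :=
  natDegree_charPol_le.antisymm (le_natDegree_of_ne_zero (by rw [coeff_charPol le_rfl, h]; simp))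

lemma monic_charPol (h : aLim n = 1) : (charPol n aLim).Monic := by
  rw [Monic, leadingCoeff, natDegree_charPol h, coeff_charPol le_rfl, h]

end CharPol

section Cofactor

variable {R : Type*} [CommRing R]

/-- The quotient `T / (X - z) ^ j`, of interest when `z` is a root of `T` of multiplicity at
least `j`. -/
noncomputable def cofactor (T : R[X]) (z : R) (j : ℕ) : R[X] := T /ₘ (X - C z) ^ j

variable {T : R[X]} {z : R} {j : ℕ}

lemma cofactor_zero (T : R[X]) (z : R) : cofactor T z 0 = T := by
  rw [cofactor, pow_zero, divByMonic_one]

lemma cofactor_eq_of_mul_eq {q : R[X]} (h : (X - C z) ^ j * q = T) : cofactor T z j = q := by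
  rw [cofactor, ← h, mul_divByMonic_cancel_left _ ((monic_X_sub_C z).pow j)]

lemma pow_mul_cofactor (hj : j ≤ T.rootMultiplicity z) : (X - C z) ^ j * cofactor T z j = T := by
  obtain ⟨q, hq⟩ := (pow_dvd_pow (X - C z) hj).trans (pow_rootMultiplicity_dvd T z)
  rw [cofactor_eq_of_mul_eq hq.symm, ← hq]

lemma mul_cofactor_succ (hj : j + 1 ≤ T.rootMultiplicity z) :
    (X - C z) * cofactor T z (j + 1) = cofactor T z j := by
  refine (cofactor_eq_of_mul_eq ?_).symm
  rw [← mul_assoc, ← pow_succ, pow_mul_cofactor hj]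

variable [Nontrivial R]

lemma natDegree_cofactor_succ_lt (hT : T.natDegree ≠ 0) (z : R) (j : ℕ) :
    (cofactor T z (j + 1)).natDegree < T.natDegree := by
  rw [cofactor, natDegree_divByMonic _ ((monic_X_sub_C z).pow _),
    (monic_X_sub_C z).natDegree_pow, natDegree_X_sub_C]
  omega

lemma degree_cofactor_succ_lt (hT : T ≠ 0) (z : R) (j : ℕ) :
    (cofactor T z (j + 1)).degree < T.degree := by
  refine degree_divByMonic_lt _ _ hT ?_
  rw [← natDegree_pos_iff_degree_pos, (monic_X_sub_C z).natDegree_pow, natDegree_X_sub_C]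
  omega

end Cofactor

section PartialFractions

variable {T : ℂ[X]}

/-- The pairs consisting of a root of `T` and a number below its multiplicity. They index the
balanced coordinates of a solution. -/
abbrev RootIndex (T : ℂ[X]) : Type :=
  Σ z : T.roots.toFinset, Fin (Polynomial.rootMultiplicity (z : ℂ) T)

/-- The root belonging to an index. -/
def root (T : ℂ[X]) (i : RootIndex T) : ℂ := i.1

lemma prod_roots_eq (hT : T.Monic) :
    ∏ z ∈ T.roots.toFinset, (X - C z) ^ T.rootMultiplicity z = T := by
  rw [← prod_multiset_root_eq_finset_root]
  exact prod_multiset_X_sub_C_of_monic_of_roots_card_eq hT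
    (splits_iff_card_roots.1 (IsAlgClosed.splits T))

lemma pow_mul_prod_erase_roots (hT : T.Monic) {z : ℂ} (hz : z ∈ T.roots.toFinset)
    (j : Fin (T.rootMultiplicity z)) :
    (X - C z) ^ (j : ℕ) * ∏ w ∈ T.roots.toFinset.erase z, (X - C w) ^ T.rootMultiplicity w =
      cofactor T z ((Fin.rev j : ℕ) + 1) := by
  refine (cofactor_eq_of_mul_eq ?_).symm
  rw [← mul_assoc, ← pow_add, Fin.val_rev,
    show T.rootMultiplicity z - (j + 1) + 1 + j = T.rootMultiplicity z by omega,
    Finset.mul_prod_erase (f := fun w => (X - C w) ^ T.rootMultiplicity w) _ hz, prod_roots_eq hT]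

lemma degree_sum_cofactor_lt (hT : T ≠ 0) (c : RootIndex T → ℂ) :
    (∑ i, C (c i) * cofactor T (root T i) (i.2 + 1)).degree < T.degree := by
  refine (degree_sum_le _ _).trans_lt ((Finset.sup_lt_iff ?_).2 fun i _ => ?_)
  · exact bot_lt_iff_ne_bot.2 fun h => hT (degree_eq_bot.1 h)
  · rw [← smul_eq_C_mul]
    exact (degree_smul_le _ _).trans_lt (degree_cofactor_succ_lt hT _ _)

lemma exists_eq_sum_cofactor (hT : T.Monic) {f : ℂ[X]} (hf : f.degree < T.degree) :
    ∃ c : RootIndex T → ℂ, f = ∑ i, C (c i) * cofactor T (root T i) (i.2 + 1) := by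
  obtain ⟨q, r, hr, hfr⟩ := eq_quo_mul_prod_pow_add_sum_rem_mul_prod_pow (s := T.roots.toFinset) f
    (g := fun z : ℂ => X - C z) (fun z _ => monic_X_sub_C z)
    (fun z _ w _ hzw => pairwise_coprime_X_sub_C Function.injective_id hzw)
    (fun z => T.rootMultiplicity z)
  rw [prod_roots_eq hT] at hfr
  have hr_const : ∀ z ∈ T.roots.toFinset, ∀ j, r z j = C ((r z j).coeff 0) := fun z hz j =>
    eq_C_of_degree_le_zero (Nat.WithBot.lt_one_iff_le_zero.1 (degree_X_sub_C z ▸ hr z hz j))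
  let c : RootIndex T → ℂ := fun i => (r i.1 (Fin.rev i.2)).coeff 0
  have hsum : ∑ z ∈ T.roots.toFinset, ∑ j, r z j * (X - C z) ^ (j : ℕ) *
        ∏ w ∈ T.roots.toFinset.erase z, (X - C w) ^ T.rootMultiplicity w =
      ∑ i, C (c i) * cofactor T (root T i) (i.2 + 1) := by
    rw [Fintype.sum_sigma, ← Finset.sum_coe_sort]
    refine Finset.sum_congr rfl fun z _ => ?_
    rw [← Equiv.sum_comp Fin.revPerm]
    refine Finset.sum_congr rfl fun j _ => ?_
    rw [Fin.revPerm_apply, mul_assoc, pow_mul_prod_erase_roots hT z.2, Fin.rev_rev,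
      hr_const z z.2]
    rfl
  rw [hsum] at hfr
  refine ⟨c, ?_⟩
  have hmod := (div_modByMonic_unique (f := f) q _ hT
    ⟨by rw [hfr]; ring, degree_sum_cofactor_lt hT.ne_zero c⟩).2
  rwa [(modByMonic_eq_self_iff hT).2 hf] at hmod

lemma card_filter_norm_root (T : ℂ[X]) (r : ℝ) :
    (Finset.univ.filter fun i => ‖root T i‖ = r).card = multSum T r := by
  rw [Finset.card_filter, Fintype.sum_sigma, multSum, Finset.sum_filter,
    ← Finset.sum_coe_sort T.roots.toFinset]
  refine Finset.sum_congr rfl fun z _ => ?_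
  change ∑ _, (if ‖(z : ℂ)‖ = r then 1 else 0) = _
  split_ifs <;> simp

lemma card_rootIndex (T : ℂ[X]) : Fintype.card (RootIndex T) = T.natDegree := by
  rw [Fintype.card_sigma, ← splits_iff_card_roots.1 (IsAlgClosed.splits T),
    ← Multiset.toFinset_sum_count_eq, ← Finset.sum_coe_sort T.roots.toFinset]
  simp only [Fintype.card_fin, count_roots]

lemma rootMultiplicity_le_multMax {z : ℂ} (hz : z ∈ T.roots.toFinset) :
    T.rootMultiplicity z ≤ multMax T ‖z‖ :=
  Finset.le_sup (f := fun z => T.rootMultiplicity z) (Finset.mem_filter.2 ⟨hz, rfl⟩)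

end PartialFractions

section ShiftOperator

variable {m : ℕ}

/-- The operator `y(ν) ↦ y(ν + 1)`. -/
noncomputable def shiftOp (m : ℕ) : Module.End ℂ (Set.Ici m → ℂ) :=
  LinearMap.funLeft ℂ ℂ fun ν => shift ν 1

lemma shiftOp_apply (y : Set.Ici m → ℂ) (ν : Set.Ici m) : shiftOp m y ν = y (shift ν 1) := rfl

lemma shiftOp_pow_apply (j : ℕ) (y : Set.Ici m → ℂ) (ν : Set.Ici m) :
    (shiftOp m ^ j) y ν = y (shift ν j) := by
  induction j generalizing ν with
  | zero => rfl
  | succ j ih =>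
    rw [pow_succ', Module.End.mul_apply, shiftOp_apply, ih, shift_shift, add_comm]

lemma aeval_shiftOp_apply {P : ℂ[X]} {N : ℕ} (hP : P.natDegree < N) (y : Set.Ici m → ℂ)
    (ν : Set.Ici m) :
    aeval (shiftOp m) P y ν = ∑ k ∈ Finset.range N, P.coeff k * y (shift ν k) := by
  rw [aeval_eq_sum_range' hP]
  simp [LinearMap.sum_apply, shiftOp_pow_apply]

lemma aeval_shiftOp_X_pow_apply (j : ℕ) (y : Set.Ici m → ℂ) (ν : Set.Ici m) :
    aeval (shiftOp m) (X ^ j : ℂ[X]) y ν = y (shift ν j) := by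
  rw [map_pow, aeval_X, shiftOp_pow_apply]

lemma aeval_shiftOp_apply_shift (P : ℂ[X]) (z : ℂ) (y : Set.Ici m → ℂ) (ν : Set.Ici m) :
    aeval (shiftOp m) P y (shift ν 1) =
      z * aeval (shiftOp m) P y ν + aeval (shiftOp m) ((X - C z) * P) y ν := by
  rw [sub_mul, map_sub, map_mul, map_mul, aeval_X, aeval_C, LinearMap.sub_apply,
    Module.End.mul_apply, Module.End.mul_apply, Module.algebraMap_end_apply, Pi.sub_apply,
    shiftOp_apply, Pi.smul_apply, smul_eq_mul]
  ring

lemma norm_aeval_shiftOp_le {P : ℂ[X]} {n : ℕ} (hP : P.natDegree < n) (y : Set.Ici m → ℂ)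
    (ν : Set.Ici m) :
    ‖aeval (shiftOp m) P y ν‖ ≤ (∑ k ∈ Finset.range n, ‖P.coeff k‖) * omega n y ν := by
  rw [aeval_shiftOp_apply hP, Finset.sum_mul]
  refine (norm_sum_le _ _).trans (Finset.sum_le_sum fun k hk => ?_)
  rw [norm_mul]
  exact mul_le_mul_of_nonneg_left (norm_le_omega y ν (Finset.mem_range.1 hk)) (norm_nonneg _)

end ShiftOperator

section WeightedStep

lemma rpow_add_one_le {x β : ℝ} (hx : 0 < x) (hβ0 : 0 ≤ β) (hβ1 : β ≤ 1) :
    (x + 1) ^ β ≤ x ^ β * (1 + x⁻¹) := by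
  have hinv : 0 ≤ x⁻¹ := by positivity
  rw [show x + 1 = x * (1 + x⁻¹) by field_simp, Real.mul_rpow hx.le (by positivity)]
  refine mul_le_mul_of_nonneg_left ?_ (by positivity)
  calc (1 + x⁻¹) ^ β ≤ 1 + β * x⁻¹ :=
        rpow_one_add_le_one_add_mul_self (by linarith) hβ0 hβ1
    _ ≤ 1 + x⁻¹ := by linarith [mul_le_mul_of_nonneg_right hβ1 hinv]

lemma norm_rpow_mul_add_sub_le {x β : ℝ} {z w p : ℂ} (hx : 1 ≤ x) (hβ0 : 0 ≤ β) (hβ1 : β ≤ 1) :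
    ‖(((x + 1) ^ β : ℝ) : ℂ) * (z * w + p) - z * (((x ^ β : ℝ) : ℂ) * w)‖ ≤
      ‖z‖ * x⁻¹ * (x ^ β * ‖w‖) + 2 * (x ^ β * ‖p‖) := by
  have hx0 : 0 < x := by linarith
  have hpow : 0 ≤ x ^ β := by positivity
  have hmono : x ^ β ≤ (x + 1) ^ β := Real.rpow_le_rpow hx0.le (by linarith) hβ0
  have hdiff : (x + 1) ^ β - x ^ β ≤ x⁻¹ * x ^ β := by
    linarith [rpow_add_one_le hx0 hβ0 hβ1]
  have hdouble : (x + 1) ^ β ≤ 2 * x ^ β := by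
    linarith [mul_le_mul_of_nonneg_right (inv_le_one_of_one_le₀ hx) hpow]
  calc _ = ‖(((x + 1) ^ β - x ^ β : ℝ) : ℂ) * (z * w) + (((x + 1) ^ β : ℝ) : ℂ) * p‖ := by
        push_cast
        ring_nf
    _ ≤ ((x + 1) ^ β - x ^ β) * (‖z‖ * ‖w‖) + (x + 1) ^ β * ‖p‖ := by
        refine (norm_add_le _ _).trans_eq ?_
        rw [norm_mul, norm_mul, norm_mul, Complex.norm_real, Complex.norm_real,
          Real.norm_of_nonneg (by linarith), Real.norm_of_nonneg (by positivity)]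
    _ ≤ x⁻¹ * x ^ β * (‖z‖ * ‖w‖) + 2 * x ^ β * ‖p‖ := by gcongr
    _ = _ := by ring

end WeightedStep

section Coordinates

/-- The exponent of the weight that balances the coordinates belonging to a multiple root: the
weights of consecutive coordinates of a root of absolute value `r` differ by the factor
`ν ^ (1 / multMax T r)`. -/
noncomputable def weightExp (T : ℂ[X]) (i : RootIndex T) : ℝ :=
  1 - ((i.2 : ℕ) + 1 : ℝ) / multMax T ‖root T i‖

/-- The weighted coordinates of a sequence at the point `ν`: the values at `ν` of the sequences
`T / (X - z) ^ j` applied to it, for the roots `z` of `T` and the positive `j` up to the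
multiplicity of `z`. -/
noncomputable def coord (T : ℂ[X]) {m : ℕ} (ν : Set.Ici m) :
    (Set.Ici m → ℂ) →ₗ[ℂ] (RootIndex T → ℂ) :=
  LinearMap.pi fun i => ((((ν : ℕ) : ℝ) ^ weightExp T i : ℝ) : ℂ) •
    (LinearMap.proj ν).comp
      (aeval (shiftOp m) (cofactor T (root T i) (i.2 + 1)) : Module.End ℂ (Set.Ici m → ℂ))

variable {T : ℂ[X]} {m : ℕ}

lemma coord_apply (ν : Set.Ici m) (y : Set.Ici m → ℂ) (i : RootIndex T) :
    coord T ν y i = ((((ν : ℕ) : ℝ) ^ weightExp T i : ℝ) : ℂ) *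
      aeval (shiftOp m) (cofactor T (root T i) (i.2 + 1)) y ν := rfl

lemma norm_coord_apply (ν : Set.Ici m) (y : Set.Ici m → ℂ) (i : RootIndex T) :
    ‖coord T ν y i‖ = ((ν : ℕ) : ℝ) ^ weightExp T i *
      ‖aeval (shiftOp m) (cofactor T (root T i) (i.2 + 1)) y ν‖ := by
  rw [coord_apply, norm_mul, Complex.norm_real, Real.norm_of_nonneg (by positivity)]

lemma succ_le_multMax (i : RootIndex T) : (i.2 : ℕ) + 1 ≤ multMax T ‖root T i‖ :=
  (Nat.succ_le_of_lt i.2.2).trans (rootMultiplicity_le_multMax i.1.2)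

lemma one_le_multMax (i : RootIndex T) : 1 ≤ multMax T ‖root T i‖ :=
  (Nat.le_add_left 1 i.2).trans (succ_le_multMax i)

lemma exists_norm_root_eq {r : ℝ} (h : 0 < multSum T r) : ∃ i, ‖root T i‖ = r := by
  rw [← card_filter_norm_root, Finset.card_pos] at h
  obtain ⟨i, hi⟩ := h
  exact ⟨i, (Finset.mem_filter.1 hi).2⟩

lemma one_le_multMax_of_pos {r : ℝ} (h : 0 < multSum T r) : 1 ≤ multMax T r := by
  obtain ⟨i, rfl⟩ := exists_norm_root_eq h
  exact one_le_multMax i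

lemma weightExp_nonneg (i : RootIndex T) : 0 ≤ weightExp T i := by
  rw [weightExp, sub_nonneg, div_le_one (by exact_mod_cast one_le_multMax i)]
  exact_mod_cast succ_le_multMax i

lemma weightExp_le_one (i : RootIndex T) : weightExp T i ≤ 1 := by
  rw [weightExp, sub_le_self_iff]
  positivity

lemma rpow_weightExp_zero {ν : ℕ} (hν : 1 ≤ ν) (z : T.roots.toFinset)
    (h : 0 < T.rootMultiplicity (z : ℂ)) :
    (ν : ℝ) ^ weightExp T ⟨z, ⟨0, h⟩⟩ * (ν : ℝ)⁻¹ = rateStep (multMax T ‖(z : ℂ)‖) ν := by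
  rw [← div_eq_mul_inv, ← Real.rpow_sub_one (by positivity), weightExp, rateStep, root]
  congr 1
  push_cast
  ring

lemma rpow_weightExp_succ {ν j : ℕ} (hν : 1 ≤ ν) (z : T.roots.toFinset)
    (h : j + 1 < T.rootMultiplicity (z : ℂ)) :
    (ν : ℝ) ^ weightExp T ⟨z, ⟨j + 1, h⟩⟩ =
      rateStep (multMax T ‖(z : ℂ)‖) ν *
        (ν : ℝ) ^ weightExp T ⟨z, ⟨j, (Nat.lt_succ_self j).trans h⟩⟩ := by
  rw [rateStep, ← Real.rpow_add (by positivity), weightExp, weightExp, root, root]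
  congr 1
  push_cast
  ring

lemma norm_aeval_le_norm_coord {ν : Set.Ici m} (hν : 1 ≤ (ν : ℕ)) (y : Set.Ici m → ℂ)
    (i : RootIndex T) :
    ‖aeval (shiftOp m) (cofactor T (root T i) (i.2 + 1)) y ν‖ ≤ ‖coord T ν y‖ := by
  refine le_trans ?_ (norm_le_pi_norm _ i)
  rw [norm_coord_apply]
  exact le_mul_of_one_le_left (norm_nonneg _)
    (Real.one_le_rpow (by exact_mod_cast hν) (weightExp_nonneg i))

lemma exists_norm_coord_le (hT : T.natDegree ≠ 0) :
    ∃ C : ℝ, 1 ≤ C ∧ ∀ (m : ℕ) (ν : Set.Ici m), 1 ≤ (ν : ℕ) → ∀ y : Set.Ici m → ℂ,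
      ‖coord T ν y‖ ≤ C * (ν : ℕ) * omega T.natDegree y ν := by
  let c : RootIndex T → ℝ := fun i =>
    ∑ k ∈ Finset.range T.natDegree, ‖(cofactor T (root T i) (i.2 + 1)).coeff k‖
  have hc : ∀ i, 0 ≤ c i := fun i => Finset.sum_nonneg fun _ _ => norm_nonneg _
  have hsum : 0 ≤ ∑ i, c i := Finset.sum_nonneg fun i _ => hc i
  refine ⟨1 + ∑ i, c i, by linarith, fun m ν hν y => ?_⟩
  have hω := omega_nonneg (n := T.natDegree) y ν
  refine (pi_norm_le_iff_of_nonneg (by positivity)).2 fun i => ?_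
  have hweight : ((ν : ℕ) : ℝ) ^ weightExp T i ≤ (ν : ℕ) := by
    simpa using Real.rpow_le_rpow_of_exponent_le (by exact_mod_cast hν) (weightExp_le_one i)
  have hci : c i ≤ 1 + ∑ i, c i := by
    linarith [Finset.single_le_sum (fun i _ => hc i) (Finset.mem_univ i)]
  calc _ = ((ν : ℕ) : ℝ) ^ weightExp T i * _ := norm_coord_apply ν y i
    _ ≤ (ν : ℕ) * (c i * omega T.natDegree y ν) :=
        mul_le_mul hweight (norm_aeval_shiftOp_le (natDegree_cofactor_succ_lt hT _ _) y ν)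
          (norm_nonneg _) (by positivity)
    _ ≤ (ν : ℕ) * ((1 + ∑ i, c i) * omega T.natDegree y ν) := by gcongr
    _ = _ := by ring

lemma exists_omega_le (hT : T.Monic) :
    ∃ C : ℝ, 1 ≤ C ∧ ∀ (m : ℕ) (ν : Set.Ici m), 1 ≤ (ν : ℕ) → ∀ y : Set.Ici m → ℂ,
      omega T.natDegree y ν ≤ C * ‖coord T ν y‖ := by
  have hX : ∀ j : Fin T.natDegree, ∃ c : RootIndex T → ℂ,
      (X ^ (j : ℕ) : ℂ[X]) = ∑ i, C (c i) * cofactor T (root T i) (i.2 + 1) := fun j =>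
    exists_eq_sum_cofactor hT (by
      rw [degree_X_pow, degree_eq_natDegree hT.ne_zero]
      exact_mod_cast j.2)
  choose c hc using hX
  have hb : ∀ j, 0 ≤ ∑ i, ‖c j i‖ := fun j => Finset.sum_nonneg fun _ _ => norm_nonneg _
  have hsum : 0 ≤ ∑ j, ∑ i, ‖c j i‖ := Finset.sum_nonneg fun j _ => hb j
  refine ⟨1 + ∑ j, ∑ i, ‖c j i‖, by linarith, fun m ν hν y => ?_⟩
  refine omega_le (by positivity) fun j hj => ?_
  have hcj : ∑ i, ‖c ⟨j, hj⟩ i‖ ≤ 1 + ∑ j, ∑ i, ‖c j i‖ := by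
    linarith [Finset.single_le_sum (fun j _ => hb j)
      (Finset.mem_univ (⟨j, hj⟩ : Fin T.natDegree))]
  rw [← aeval_shiftOp_X_pow_apply j y, hc ⟨j, hj⟩]
  simp only [map_sum, map_mul, aeval_C, LinearMap.sum_apply, Finset.sum_apply,
    Module.End.mul_apply, Module.algebraMap_end_apply, Pi.smul_apply, smul_eq_mul]
  calc _ ≤ ∑ i, ‖c ⟨j, hj⟩ i‖ * ‖coord T ν y‖ := by
        refine (norm_sum_le _ _).trans (Finset.sum_le_sum fun i _ => ?_)
        rw [norm_mul]
        exact mul_le_mul_of_nonneg_left (norm_aeval_le_norm_coord hν y i) (norm_nonneg _)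
    _ = (∑ i, ‖c ⟨j, hj⟩ i‖) * ‖coord T ν y‖ := by rw [Finset.sum_mul]
    _ ≤ _ := by gcongr

lemma rpow_mul_norm_aeval_cofactor_le {ν : Set.Ici m} (hν : 1 ≤ (ν : ℕ)) {y : Set.Ici m → ℂ}
    {E : ℝ} (hE : 0 ≤ E)
    (h : ‖aeval (shiftOp m) T y ν‖ ≤ E * ((ν : ℕ) : ℝ)⁻¹ * ‖coord T ν y‖) (i : RootIndex T) :
    ((ν : ℕ) : ℝ) ^ weightExp T i * ‖aeval (shiftOp m) (cofactor T (root T i) i.2) y ν‖ ≤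
      (1 + E) * rateStep (multMax T ‖root T i‖) ν * ‖coord T ν y‖ := by
  have hstep := rateStep_nonneg (multMax T ‖root T i‖) ν
  obtain ⟨z, ⟨j, hj⟩⟩ := i
  rcases j with _ | j
  · simp only [cofactor_zero]
    calc _ ≤ ((ν : ℕ) : ℝ) ^ weightExp T ⟨z, ⟨0, hj⟩⟩ *
          (E * ((ν : ℕ) : ℝ)⁻¹ * ‖coord T ν y‖) := by gcongr
      _ = E * (((ν : ℕ) : ℝ) ^ weightExp T ⟨z, ⟨0, hj⟩⟩ * ((ν : ℕ) : ℝ)⁻¹) * ‖coord T ν y‖ := by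
          ring
      _ ≤ _ := by
          rw [rpow_weightExp_zero hν]
          gcongr ?_ * _ * _
          linarith
  · have hcoord := norm_le_pi_norm (coord T ν y) ⟨z, ⟨j, (Nat.lt_succ_self j).trans hj⟩⟩
    rw [norm_coord_apply] at hcoord
    rw [rpow_weightExp_succ hν, mul_assoc, mul_assoc]
    refine (mul_le_mul_of_nonneg_left hcoord hstep).trans (le_mul_of_one_le_left ?_ ?_)
    · positivity
    · linarith

lemma norm_coord_succ_sub_le {ν : Set.Ici m} (hν : 1 ≤ (ν : ℕ)) {y : Set.Ici m → ℂ}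
    {E : ℝ} (hE : 0 ≤ E)
    (h : ‖aeval (shiftOp m) T y ν‖ ≤ E * ((ν : ℕ) : ℝ)⁻¹ * ‖coord T ν y‖) (i : RootIndex T) :
    ‖coord T (shift ν 1) y i - root T i * coord T ν y i‖ ≤
      (‖root T i‖ + 2 * (1 + E)) * rateStep (multMax T ‖root T i‖) ν * ‖coord T ν y‖ := by
  have hcast : (((shift ν 1 : Set.Ici m) : ℕ) : ℝ) = (ν : ℕ) + 1 := by
    rw [coe_shift, Nat.cast_add_one]
  have hcoord := norm_le_pi_norm (coord T ν y) i
  rw [norm_coord_apply] at hcoord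
  have hcofactor : (X - C (root T i)) * cofactor T (root T i) (i.2 + 1) =
      cofactor T (root T i) i.2 := mul_cofactor_succ (Nat.succ_le_of_lt i.2.2)
  rw [coord_apply, coord_apply, aeval_shiftOp_apply_shift _ (root T i), hcast, hcofactor]
  refine (norm_rpow_mul_add_sub_le (by exact_mod_cast hν) (weightExp_nonneg i)
    (weightExp_le_one i)).trans ?_
  calc _ ≤ ‖root T i‖ * rateStep (multMax T ‖root T i‖) ν * ‖coord T ν y‖ +
        2 * ((1 + E) * rateStep (multMax T ‖root T i‖) ν * ‖coord T ν y‖) := by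
        have hstep := rateStep_nonneg (multMax T ‖root T i‖) ν
        gcongr ‖root T i‖ * ?_ * ?_ + 2 * ?_
        · exact inv_le_rateStep _ hν
        · exact rpow_mul_norm_aeval_cofactor_le hν hE h i
    _ = _ := by ring

end Coordinates

section Solutions

variable {n m : ℕ} {a : ℕ → ℕ → ℂ} {aLim : ℕ → ℂ}

lemma exists_eventually_sum_norm_sub_le
    (ha : ∀ i ≤ n, (fun ν : ℕ => a i ν - aLim i) =O[atTop] (fun ν : ℕ => 1 / ((ν : ℝ) + 1))) :
    ∃ D : ℝ, 0 ≤ D ∧ ∀ᶠ ν : ℕ in atTop,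
      ∑ k ∈ Finset.range n, ‖a k ν - aLim k‖ ≤ D * (ν : ℝ)⁻¹ := by
  have hsum : (fun ν : ℕ => ∑ k ∈ Finset.range n, ‖a k ν - aLim k‖) =O[atTop]
      (fun ν : ℕ => 1 / ((ν : ℝ) + 1)) := by
    simpa only [Finset.sum_fn] using
      IsBigO.sum fun k hk => (ha k (Finset.mem_range.1 hk).le).norm_left
  obtain ⟨D, hD, hbound⟩ := hsum.exists_nonneg
  refine ⟨D, hD, ?_⟩
  filter_upwards [hbound.bound, eventually_ge_atTop 1] with ν hν hν1
  refine (le_abs_self _).trans (hν.trans ?_)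
  rw [Real.norm_of_nonneg (by positivity), one_div]
  gcongr
  linarith

lemma eq_one_of_isBigO (ha_lead : ∀ ν : ℕ, a n ν = 1)
    (ha : (fun ν : ℕ => a n ν - aLim n) =O[atTop] (fun ν : ℕ => 1 / ((ν : ℝ) + 1))) :
    aLim n = 1 := by
  have hlim := ha.trans_tendsto tendsto_one_div_add_atTop_nhds_zero_nat
  simp only [ha_lead] at hlim
  exact (sub_eq_zero.1 (tendsto_nhds_unique tendsto_const_nhds hlim)).symm

lemma norm_aeval_charPol_le (ha_lead : ∀ ν : ℕ, a n ν = 1) (h1 : aLim n = 1)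
    {y : Set.Ici m → ℂ} (hy : y ∈ solutionSpace n a m) (ν : Set.Ici m) :
    ‖aeval (shiftOp m) (charPol n aLim) y ν‖ ≤
      (∑ k ∈ Finset.range n, ‖a k ν - aLim k‖) * omega n y ν := by
  rw [aeval_shiftOp_apply (Nat.lt_succ_of_le natDegree_charPol_le), Finset.sum_range_succ,
    coeff_charPol le_rfl, h1, one_mul, solution_apply_add ha_lead hy, ← sub_eq_add_neg,
    ← Finset.sum_sub_distrib, Finset.sum_mul]
  refine (norm_sum_le _ _).trans (Finset.sum_le_sum fun k hk => ?_)
  have hkn := Finset.mem_range.1 hk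
  rw [coeff_charPol hkn.le, ← sub_mul, norm_mul, norm_sub_rev]
  exact mul_le_mul_of_nonneg_left (norm_le_omega y ν hkn) (norm_nonneg _)

lemma exists_eventually_norm_aeval_charPol_le (ha_lead : ∀ ν : ℕ, a n ν = 1)
    (ha : ∀ i ≤ n, (fun ν : ℕ => a i ν - aLim i) =O[atTop] (fun ν : ℕ => 1 / ((ν : ℝ) + 1))) :
    ∃ E : ℝ, 0 ≤ E ∧ ∀ᶠ m : ℕ in atTop, ∀ y ∈ solutionSpace n a m, ∀ ν : Set.Ici m,
      ‖aeval (shiftOp m) (charPol n aLim) y ν‖ ≤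
        E * ((ν : ℕ) : ℝ)⁻¹ * ‖coord (charPol n aLim) ν y‖ := by
  have h1 := eq_one_of_isBigO ha_lead (ha n le_rfl)
  obtain ⟨D, hD, hev⟩ := exists_eventually_sum_norm_sub_le ha
  obtain ⟨C, hC, hω⟩ := exists_omega_le (monic_charPol h1)
  rw [natDegree_charPol h1] at hω
  refine ⟨D * C, by positivity, ?_⟩
  filter_upwards [eventually_forall_ge_atTop.2 hev, eventually_ge_atTop 1] with m hm hm1 y hy ν
  calc _ ≤ (∑ k ∈ Finset.range n, ‖a k ν - aLim k‖) * omega n y ν :=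
        norm_aeval_charPol_le ha_lead h1 hy ν
    _ ≤ D * ((ν : ℕ) : ℝ)⁻¹ * (C * ‖coord (charPol n aLim) ν y‖) :=
        mul_le_mul (hm ν ν.2) (hω m ν (hm1.trans ν.2) y) (omega_nonneg _ _) (by positivity)
    _ = _ := by ring

lemma exists_eventually_norm_coord_succ_sub_le (ha_lead : ∀ ν : ℕ, a n ν = 1)
    (ha : ∀ i ≤ n, (fun ν : ℕ => a i ν - aLim i) =O[atTop] (fun ν : ℕ => 1 / ((ν : ℝ) + 1)))
    {T : ℂ[X]} (hT : T = charPol n aLim) :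
    ∃ C : ℝ, 1 ≤ C ∧ ∀ᶠ m : ℕ in atTop, ∀ y ∈ solutionSpace n a m, ∀ ν : Set.Ici m, ∀ i,
      ‖coord T (shift ν 1) y i - root T i * coord T ν y i‖ ≤
        C * rateStep (multMax T ‖root T i‖) ν * ‖coord T ν y‖ := by
  subst hT
  set T := charPol n aLim
  obtain ⟨E, hE, hev⟩ := exists_eventually_norm_aeval_charPol_le ha_lead ha
  have hR : 0 ≤ ∑ i, ‖root T i‖ := Finset.sum_nonneg fun _ _ => norm_nonneg _
  refine ⟨∑ i, ‖root T i‖ + 2 * (1 + E), by linarith, ?_⟩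
  filter_upwards [hev, eventually_ge_atTop 1] with m hm hm1 y hy ν i
  refine (norm_coord_succ_sub_le (hm1.trans ν.2) hE (hm y hy ν) i).trans ?_
  have := rateStep_nonneg (multMax T ‖root T i‖) ν
  gcongr
  exact Finset.single_le_sum (f := fun i => ‖root T i‖) (fun _ _ => norm_nonneg _)
    (Finset.mem_univ i)

/-- The weighted coordinates at the point `m + t` of the solutions. -/
noncomputable def solCoord (n : ℕ) (a : ℕ → ℕ → ℂ) (T : ℂ[X]) (m t : ℕ) :
    solutionSpace n a m →ₗ[ℂ] (RootIndex T → ℂ) :=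
  (coord T (shift (start m) t)).comp (solutionSpace n a m).subtype

lemma solCoord_zero_bijective (ha_lead : ∀ ν : ℕ, a n ν = 1) (h1 : aLim n = 1) (hm : 1 ≤ m) :
    Function.Bijective (solCoord n a (charPol n aLim) m 0) := by
  have hinj : Function.Injective (solCoord n a (charPol n aLim) m 0) := by
    rw [← LinearMap.ker_eq_bot, LinearMap.ker_eq_bot']
    intro y hy
    obtain ⟨C, -, hω⟩ := exists_omega_le (monic_charPol (n := n) h1)
    have hy0 := hω m (start m) hm (y : Set.Ici m → ℂ)
    rw [natDegree_charPol h1, show coord (charPol n aLim) (start m) (y : Set.Ici m → ℂ) = 0 from hy,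
      norm_zero, mul_zero] at hy0
    refine window_injective ha_lead ?_
    rw [map_zero]
    exact norm_le_zero_iff.1 hy0
  have := finiteDimensional_solutionSpace (m := m) ha_lead
  refine ⟨hinj, (LinearMap.injective_iff_surjective_of_finrank_eq_finrank ?_).1 hinj⟩
  rw [finrank_solutionSpace ha_lead, Module.finrank_fintype_fun_eq_card, card_rootIndex,
    natDegree_charPol h1]

end Solutions

section Absorption

lemma le_exp_mul {E x : ℝ} (hE : 0 ≤ E) (hx : 1 ≤ x) : E ≤ Real.exp (E * x) :=
  (le_mul_of_one_le_right hE hx).trans ((le_add_of_nonneg_right zero_le_one).trans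
    (Real.add_one_le_exp _))

lemma mul_exp_le_exp_add {E c A x : ℝ} (hE : 0 ≤ E) (hx : 1 ≤ x) (hA : E + c ≤ A) :
    E * Real.exp (c * x) ≤ Real.exp (A * x) :=
  calc E * Real.exp (c * x) ≤ Real.exp (E * x) * Real.exp (c * x) := by
        gcongr; exact le_exp_mul hE hx
    _ = Real.exp ((E + c) * x) := by rw [← Real.exp_add]; ring_nf
    _ ≤ Real.exp (A * x) := by gcongr

lemma mul_nat_mul_exp_rate_le {E c A : ℝ} {k ν : ℕ} (hE : 0 ≤ E) (hν : 1 ≤ ν)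
    (hA : E + 1 + c ≤ A) :
    E * ν * Real.exp (-A * rate k ν) ≤ Real.exp (-(c * rate k ν)) := by
  have hν0 : (0 : ℝ) < ν := by exact_mod_cast hν
  have hνexp : (ν : ℝ) ≤ Real.exp (rate k ν) :=
    (Real.log_le_iff_le_exp hν0).1 (log_le_rate k ν)
  calc E * ν * Real.exp (-A * rate k ν)
      ≤ E * Real.exp (rate k ν) * Real.exp (-A * rate k ν) := by gcongr
    _ = E * Real.exp ((1 - A) * rate k ν) := by
        rw [mul_assoc, ← Real.exp_add]; ring_nf
    _ ≤ Real.exp (-c * rate k ν) := mul_exp_le_exp_add hE (one_le_rate k hν) (by linarith)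
    _ = _ := by rw [neg_mul]

lemma mul_pow_mul_rpow_le_div_rpow {E B A : ℝ} {k ν : ℕ} (hE : 1 ≤ E) (hB : 0 ≤ B) (hk : 0 < k)
    (hν : 0 < ν) (hA : (E * B) ^ k ≤ A) :
    E * B ^ ν * (ν : ℝ) ^ (-((ν : ℝ) / k)) ≤ (A / ν) ^ ((ν : ℝ) / k) := by
  have hA0 : 0 ≤ A := le_trans (by positivity) hA
  have hpow : E * B ^ ν ≤ A ^ ((ν : ℝ) / k) :=
    calc E * B ^ ν ≤ E ^ ν * B ^ ν := by gcongr; exact le_self_pow₀ hE hν.ne'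
      _ = ((E * B) ^ k) ^ ((ν : ℝ) / k) := by
          rw [← mul_pow, ← Real.rpow_natCast _ k, ← Real.rpow_mul (by positivity),
            mul_div_cancel₀ _ (by positivity), Real.rpow_natCast]
      _ ≤ _ := by gcongr
  rw [Real.div_rpow hA0 (Nat.cast_nonneg ν), Real.rpow_neg (Nat.cast_nonneg ν), ← div_eq_mul_inv]
  gcongr

end Absorption

section Balanced

/-- The summand at the circle of radius `q` of the solution space, read off in the weighted
coordinates. -/
noncomputable abbrev solSummand (n : ℕ) (a : ℕ → ℕ → ℂ) (T : ℂ[X]) (m : ℕ) (γ q : ℝ) :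
    Submodule ℂ (solutionSpace n a m) :=
  growthSummand (solCoord n a T m) (root T) γ q

/-- In the weighted coordinates, which are comparable to `omega` up to a factor linear in `ν`, the
equation is from `m` on a small perturbation of a diagonal system with spectrum in the circles of
radii `ρ`. -/
structure IsBalanced (n : ℕ) {s : ℕ} (a : ℕ → ℕ → ℂ) (T : ℂ[X]) (ρ : Fin (s + 1) → ℝ) (m : ℕ)
    (γ C D : ℝ) : Prop where
  n_pos : 0 < n
  m_pos : 1 ≤ m
  γ_pos : 0 < γ
  one_le_C : 1 ≤ C
  one_le_D : 1 ≤ D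
  spectrum : IsSpectrum (root T) γ ρ
  step : ∀ y t i, ‖solCoord n a T m (t + 1) y i - root T i * solCoord n a T m t y i‖ ≤
    C * rateStep (multMax T ‖root T i‖) (m + t) * ‖solCoord n a T m t y‖
  small : ∀ i t, C * rateStep (multMax T ‖root T i‖) (m + t) ≤ γ / 3
  bijective : Function.Bijective (solCoord n a T m 0)
  omega_le : ∀ (y : solutionSpace n a m) t,
    omega n (y : Set.Ici m → ℂ) (shift (start m) t) ≤ D * ‖solCoord n a T m t y‖
  norm_le : ∀ (y : solutionSpace n a m) t,
    ‖solCoord n a T m t y‖ ≤ D * (m + t : ℕ) * omega n (y : Set.Ici m → ℂ) (shift (start m) t)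

lemma exists_gap {s : ℕ} {ρ : Fin (s + 1) → ℝ} (hρ : StrictAnti ρ) :
    ∃ γ : ℝ, 0 < γ ∧ ∀ i j, i < j → ρ j + 2 * γ ≤ ρ i := by
  have h : ∀ᶠ γ : ℝ in 𝓝[>] 0, ∀ i j, i < j → ρ j + 2 * γ ≤ ρ i := by
    refine eventually_all.2 fun i => eventually_all.2 fun j => ?_
    by_cases hij : i < j
    · have hlim : Tendsto (fun γ : ℝ => ρ j + 2 * γ) (𝓝[>] 0) (𝓝 (ρ j + 2 * 0)) :=
        (Continuous.tendsto (by fun_prop) 0).mono_left nhdsWithin_le_nhds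
      filter_upwards [hlim.eventually_lt_const (show ρ j + 2 * 0 < ρ i by simpa using hρ hij)]
        with γ hγ _ using hγ.le
    · exact Eventually.of_forall fun γ h => absurd h hij
  obtain ⟨γ, hgap, hγ⟩ := (h.and self_mem_nhdsWithin).exists
  exact ⟨γ, hγ, hgap⟩

lemma eventually_forall_mul_rateStep_le (T : ℂ[X]) (C : ℝ) {ε : ℝ} (hε : 0 < ε) :
    ∀ᶠ m : ℕ in atTop, ∀ i, C * rateStep (multMax T ‖root T i‖) m ≤ ε := by
  refine eventually_all.2 fun i => ?_
  have hlim := (tendsto_rateStep (one_le_multMax i)).const_mul C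
  rw [mul_zero] at hlim
  exact (hlim.eventually_lt_const hε).mono fun _ h => h.le

lemma exists_isBalanced {n s : ℕ} {a : ℕ → ℕ → ℂ} {aLim : ℕ → ℂ} {ρ : Fin (s + 1) → ℝ}
    (hn : 1 ≤ n) (ha_lead : ∀ ν : ℕ, a n ν = 1)
    (ha : ∀ i ≤ n, (fun ν : ℕ => a i ν - aLim i) =O[atTop] (fun ν : ℕ => 1 / ((ν : ℝ) + 1)))
    (hρ : StrictAnti ρ) (hρ_last : ρ (Fin.last s) = 0)
    (hroots : ∀ z ∈ (charPol n aLim).roots, ∃ i : Fin (s + 1), ‖z‖ = ρ i) :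
    ∃ m γ C D, IsBalanced n a (charPol n aLim) ρ m γ C D := by
  obtain ⟨γ, hγ, hgap⟩ := exists_gap hρ
  have h1 := eq_one_of_isBigO ha_lead (ha n le_rfl)
  have hdeg := natDegree_charPol (n := n) h1
  obtain ⟨C, hC, hstep⟩ := exists_eventually_norm_coord_succ_sub_le ha_lead ha rfl
  obtain ⟨D₁, hD₁, hω⟩ := exists_omega_le (monic_charPol (n := n) h1)
  obtain ⟨D₂, -, hN⟩ := exists_norm_coord_le (T := charPol n aLim) (by omega)
  rw [hdeg] at hω hN
  have hsmall := eventually_forall_mul_rateStep_le (charPol n aLim) C (ε := γ / 3) (by positivity)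
  obtain ⟨m, hstep, hsmall, hm⟩ :=
    (hstep.and ((eventually_forall_ge_atTop.2 hsmall).and (eventually_ge_atTop 1))).exists
  refine ⟨m, γ, C, max D₁ D₂,
    { n_pos := hn
      m_pos := hm
      γ_pos := hγ
      one_le_C := hC
      one_le_D := le_max_of_le_left hD₁
      spectrum := ⟨hgap, fun i => hρ_last ▸ hρ.antitone (Fin.le_last i),
        fun i => hroots _ (Multiset.mem_toFinset.1 i.1.2)⟩
      step := fun y t i => hstep y y.2 (shift (start m) t) i
      small := fun i t => hsmall (m + t) (Nat.le_add_right m t) i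
      bijective := solCoord_zero_bijective ha_lead h1 hm
      omega_le := fun y t => ?_
      norm_le := fun y t => ?_ }⟩
  · exact (hω m _ (hm.trans (shift (start m) t).2) y).trans
      (mul_le_mul_of_nonneg_right (le_max_left _ _) (norm_nonneg _))
  · refine (hN m _ (hm.trans (shift (start m) t).2) y).trans
      (mul_le_mul_of_nonneg_right ?_ (omega_nonneg _ _))
    exact mul_le_mul_of_nonneg_right (le_max_right _ _) (Nat.cast_nonneg _)

namespace IsBalanced

variable {n s m : ℕ} {a : ℕ → ℕ → ℂ} {T : ℂ[X]} {ρ : Fin (s + 1) → ℝ} {γ C D : ℝ}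
  (hb : IsBalanced n a T ρ m γ C D)

include hb

lemma isPerturbedOrbit (y : solutionSpace n a m) :
    IsPerturbedOrbit (root T) (γ / 3) fun t => solCoord n a T m t y := fun t i =>
  (hb.step y t i).trans (mul_le_mul_of_nonneg_right (hb.small i t) (norm_nonneg _))

lemma norm_zero_le (y : solutionSpace n a m) :
    ‖solCoord n a T m 0 y‖ ≤ D * m * omega n (y : Set.Ici m → ℂ) (start m) :=
  hb.norm_le y 0

lemma isInternal : DirectSum.IsInternal fun i => solSummand n a T m γ (ρ i) :=
  hb.spectrum.isInternal hb.γ_pos hb.isPerturbedOrbit hb.bijective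

lemma finrank_eq (i : Fin (s + 1)) :
    Module.finrank ℂ (solSummand n a T m γ (ρ i)) = multSum T (ρ i) := by
  rw [finrank_growthSummand hb.γ_pos hb.isPerturbedOrbit (hb.spectrum.isIsolated i)
    (hb.spectrum.nonneg i) hb.bijective, card_filter_norm_root]

lemma solSummand_le_slow {i j : Fin (s + 1)} (hij : i ≤ j) :
    solSummand n a T m γ (ρ j) ≤ slow (solCoord n a T m) (ρ i + γ) := by
  intro y hy
  refine slow_mono ?_ ?_ (mem_growthSummand.1 hy).1
  · linarith [hb.spectrum.nonneg j, hb.γ_pos]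
  · linarith [(hb.spectrum.strictAnti hb.γ_pos).antitone hij]

lemma upperSum_le_slow (i : Fin (s + 1)) :
    upperSum (fun i => solSummand n a T m γ (ρ i)) i ≤ slow (solCoord n a T m) (ρ i + γ) :=
  iSup₂_le fun _ hij => hb.solSummand_le_slow hij

lemma mul_rateStep_nonneg (k ν : ℕ) : 0 ≤ C * rateStep k ν :=
  mul_nonneg (zero_le_one.trans hb.one_le_C) (rateStep_nonneg k ν)

lemma norm_succ_le {i : Fin (s + 1)} {y : solutionSpace n a m}
    (hy : y ∈ slow (solCoord n a T m) (ρ i + γ)) (t : ℕ) :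
    ‖solCoord n a T m (t + 1) y‖ ≤
      (ρ i + C * rateStep (multMax T (ρ i)) (m + t)) * ‖solCoord n a T m t y‖ :=
  norm_succ_le_of_mem_slow hb.γ_pos hb.isPerturbedOrbit (hb.spectrum.isIsolated i)
    (hb.spectrum.nonneg i) hy (hb.mul_rateStep_nonneg _ _) fun j hj => hj ▸ hb.step y t j

lemma two_mul_le (θ : Fin s) : 2 * γ ≤ ρ θ.castSucc := by
  linarith [hb.spectrum.gap _ _ (Fin.castSucc_lt_succ (i := θ)), hb.spectrum.nonneg θ.succ]

lemma pos (θ : Fin s) : 0 < ρ θ.castSucc := by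
  linarith [hb.two_mul_le θ, hb.γ_pos]

lemma le_norm_succ {θ : Fin s} {y : solutionSpace n a m}
    (hy : y ∈ solSummand n a T m γ (ρ θ.castSucc)) (t : ℕ) :
    (ρ θ.castSucc - C * rateStep (multMax T (ρ θ.castSucc)) (m + t)) * ‖solCoord n a T m t y‖ ≤
      ‖solCoord n a T m (t + 1) y‖ :=
  le_norm_succ_of_mem_growthSummand hb.γ_pos hb.isPerturbedOrbit (hb.spectrum.isIsolated _)
    (hb.two_mul_le θ) (hb.mul_rateStep_nonneg _ _) hy fun j hj => hj ▸ hb.step y t j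

lemma mul_rateStep_le_half {θ : Fin s} (hθ : 0 < multSum T (ρ θ.castSucc)) (t : ℕ) :
    C * rateStep (multMax T (ρ θ.castSucc)) (m + t) ≤ ρ θ.castSucc / 2 := by
  obtain ⟨i, hi⟩ := exists_norm_root_eq hθ
  rw [← hi]
  linarith [hb.small i t, hb.two_mul_le θ, hb.γ_pos]

lemma eventually_upper (he : ∀ i : Fin s, 0 < multSum T (ρ i.castSucc)) (θ : Fin s) :
    ∀ᶠ A in atTop, ∀ y ∈ slow (solCoord n a T m) (ρ θ.castSucc + γ), ∀ ν : Set.Ici m,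
      omega n (y : Set.Ici m → ℂ) ν ≤ Real.exp (A * rate (multMax T (ρ θ.castSucc)) ν) *
        ρ θ.castSucc ^ (ν : ℕ) * omega n (y : Set.Ici m → ℂ) (start m) := by
  have hm := hb.m_pos
  have hq := hb.pos θ
  have hC := zero_le_one.trans hb.one_le_C
  have hD := zero_le_one.trans hb.one_le_D
  set q := ρ θ.castSucc
  filter_upwards [eventually_ge_atTop (D * (D * m) / q ^ m + 4 * (C / q))] with A hA y hy ν
  obtain ⟨t, rfl⟩ := exists_eq_shift_start ν
  have hω := omega_nonneg (n := n) (y : Set.Ici m → ℂ) (start m)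
  have hgrowth := le_pow_mul_exp_rate (N := fun t => ‖solCoord n a T m t y‖)
    (one_le_multMax_of_pos (he θ)) hm (fun _ => norm_nonneg _) hq hC (hb.norm_succ_le hy) t
  rw [coe_shift_start]
  set R := rate (multMax T q) (m + t)
  calc _ ≤ D * ‖solCoord n a T m t y‖ := hb.omega_le y t
    _ ≤ D * (q ^ t * Real.exp (4 * (C / q) * R) *
          (D * m * omega n (y : Set.Ici m → ℂ) (start m))) := by
        gcongr
        exact hgrowth.trans (by gcongr; exact hb.norm_zero_le y)
    _ = D * (D * m) / q ^ m * Real.exp (4 * (C / q) * R) * q ^ (m + t) *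
          omega n (y : Set.Ici m → ℂ) (start m) := by
        rw [pow_add]; field_simp
    _ ≤ _ := by
        gcongr
        exact mul_exp_le_exp_add (by positivity) (one_le_rate _ (by omega)) hA

lemma eventually_lower (he : ∀ i : Fin s, 0 < multSum T (ρ i.castSucc)) (θ : Fin s) :
    ∀ᶠ A in atTop, ∀ y ∈ solSummand n a T m γ (ρ θ.castSucc), ∀ ν : Set.Ici m,
      Real.exp (-A * rate (multMax T (ρ θ.castSucc)) ν) * ρ θ.castSucc ^ (ν : ℕ) *
        omega n (y : Set.Ici m → ℂ) (start m) ≤ omega n (y : Set.Ici m → ℂ) ν := by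
  have hm := hb.m_pos
  have hq := hb.pos θ
  have hC := zero_le_one.trans hb.one_le_C
  have hD := zero_lt_one.trans_le hb.one_le_D
  have hhalf := hb.mul_rateStep_le_half (he θ)
  set q := ρ θ.castSucc
  filter_upwards [eventually_ge_atTop (D * D * q ^ m + 1 + 4 * (2 * (C / q)))] with A hA y hy ν
  obtain ⟨t, rfl⟩ := exists_eq_shift_start ν
  have hgrowth := pow_mul_exp_rate_le (N := fun t => ‖solCoord n a T m t y‖)
    (one_le_multMax_of_pos (he θ)) hm (fun _ => norm_nonneg _) hq hC hhalf (hb.le_norm_succ hy) t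
  have hfactor : 0 < D * ((m + t : ℕ) : ℝ) :=
    mul_pos hD (by exact_mod_cast (by omega : 0 < m + t))
  rw [coe_shift_start]
  set R := rate (multMax T q) (m + t)
  refine le_of_mul_le_mul_left ?_ hfactor
  calc _ ≤ D * ((m + t : ℕ) : ℝ) * (Real.exp (-A * R) * q ^ (m + t) *
          (D * ‖solCoord n a T m 0 y‖)) := by gcongr; exact hb.omega_le y 0
    _ = q ^ t * (D * D * q ^ m * ((m + t : ℕ) : ℝ) * Real.exp (-A * R)) *
          ‖solCoord n a T m 0 y‖ := by rw [pow_add]; ring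
    _ ≤ q ^ t * Real.exp (-(4 * (2 * (C / q)) * R)) * ‖solCoord n a T m 0 y‖ := by
        gcongr
        exact mul_nat_mul_exp_rate_le (by positivity) (by omega) hA
    _ ≤ ‖solCoord n a T m t y‖ := hgrowth
    _ ≤ _ := hb.norm_le y t

lemma eventually_decay (hlast : ρ (Fin.last s) = 0) :
    ∀ᶠ A in atTop, 0 < multMax T (ρ (Fin.last s)) →
      ∀ y ∈ solSummand n a T m γ (ρ (Fin.last s)), ∀ ν : Set.Ici m,
      ‖(y : Set.Ici m → ℂ) ν‖ ≤
        (A / ((ν : ℕ) : ℝ)) ^ (((ν : ℕ) : ℝ) / (multMax T (ρ (Fin.last s)) : ℝ)) *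
          omega n (y : Set.Ici m → ℂ) (start m) := by
  have hm := hb.m_pos
  have hD := hb.one_le_D
  obtain ⟨B, hB, hdecay⟩ := exists_superexponential_decay (multMax T (ρ (Fin.last s))) hm
    hb.one_le_C
  have hE : 1 ≤ D * (D * m) := one_le_mul_of_one_le_of_one_le hD
    (one_le_mul_of_one_le_of_one_le hD (by exact_mod_cast hm))
  filter_upwards [eventually_ge_atTop ((D * (D * m) * B) ^ multMax T (ρ (Fin.last s)))]
    with A hA hk y hy ν
  obtain ⟨t, rfl⟩ := exists_eq_shift_start ν
  have hω := omega_nonneg (n := n) (y : Set.Ici m → ℂ) (start m)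
  have hdecay := hdecay (fun t => ‖solCoord n a T m t y‖) (fun _ => norm_nonneg _) (fun t => by
    simpa only [hlast, zero_add] using hb.norm_succ_le (mem_growthSummand.1 hy).1 t) t
  rw [coe_shift_start]
  set k := multMax T (ρ (Fin.last s))
  set ν := m + t
  calc _ ≤ omega n (y : Set.Ici m → ℂ) (shift (start m) t) :=
        norm_le_omega (y : Set.Ici m → ℂ) (shift (start m) t) hb.n_pos
    _ ≤ D * ‖solCoord n a T m t y‖ := hb.omega_le y t
    _ ≤ D * (B ^ ν * (ν : ℝ) ^ (-((ν : ℝ) / k)) *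
          (D * m * omega n (y : Set.Ici m → ℂ) (start m))) := by
        gcongr
        exact hdecay.trans (by gcongr; exact hb.norm_zero_le y)
    _ = D * (D * m) * B ^ ν * (ν : ℝ) ^ (-((ν : ℝ) / k)) *
          omega n (y : Set.Ici m → ℂ) (start m) := by ring
    _ ≤ _ := by
        gcongr
        exact mul_pow_mul_rpow_le_div_rpow hE hB.le hk (by omega) hA

lemma exists_tail_bound (θ : Fin s) :
    ∃ B : ℝ, 0 ≤ B ∧ ∀ v ∈ solSummand n a T m γ (ρ θ.castSucc),
      ∀ w ∈ slow (solCoord n a T m) (ρ θ.succ + γ), ∀ ν : Set.Ici m,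
      omega n (w : Set.Ici m → ℂ) ν ≤
        B * (ρ θ.succ + γ) ^ (ν : ℕ) * omega n ((v + w : solutionSpace n a m) : Set.Ici m → ℂ)
          (start m) := by
  have hD := zero_le_one.trans hb.one_le_D
  have hr : 0 < ρ θ.succ + γ := add_pos_of_nonneg_of_pos (hb.spectrum.nonneg θ.succ) hb.γ_pos
  refine ⟨D * (D * m) / (ρ θ.succ + γ) ^ m, by positivity, fun v hv w hw ν => ?_⟩
  obtain ⟨t, rfl⟩ := exists_eq_shift_start ν
  rw [coe_shift_start]
  calc _ ≤ D * ‖solCoord n a T m t w‖ := hb.omega_le w t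
    _ ≤ D * (‖solCoord n a T m 0 w‖ * (ρ θ.succ + γ) ^ t) := by
        gcongr
        exact hb.spectrum.norm_le_of_mem_slow hb.γ_pos hb.isPerturbedOrbit hw t
    _ ≤ D * (D * m * omega n ((v + w : solutionSpace n a m) : Set.Ici m → ℂ) (start m) *
          (ρ θ.succ + γ) ^ t) := by
        gcongr
        exact (hb.spectrum.norm_le_norm_add hb.γ_pos hb.isPerturbedOrbit hv hw).trans
          (hb.norm_zero_le (v + w))
    _ = _ := by rw [pow_add]; field_simp

lemma exists_lower_proj (he : ∀ i : Fin s, 0 < multSum T (ρ i.castSucc)) (θ : Fin s) {A : ℝ}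
    (hA : ∀ y ∈ solSummand n a T m γ (ρ θ.castSucc), ∀ ν : Set.Ici m,
      Real.exp (-A * rate (multMax T (ρ θ.castSucc)) ν) * ρ θ.castSucc ^ (ν : ℕ) *
        omega n (y : Set.Ici m → ℂ) (start m) ≤ omega n (y : Set.Ici m → ℂ) ν) :
    ∃ β : ℕ → ℝ, (∀ ν, 0 ≤ β ν) ∧ Tendsto β atTop (𝓝 0) ∧
      ∀ y ∈ upperSum (fun i => solSummand n a T m γ (ρ i)) θ.castSucc, ∀ ν : Set.Ici m,
      (omega n ((proj hb.isInternal θ.castSucc y : solutionSpace n a m) : Set.Ici m → ℂ) (start m) -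
          β ν * omega n (y : Set.Ici m → ℂ) (start m)) *
        ρ θ.castSucc ^ (ν : ℕ) * Real.exp (-A * rate (multMax T (ρ θ.castSucc)) ν) ≤
      omega n (y : Set.Ici m → ℂ) ν := by
  have hq := hb.pos θ
  have hr : 0 < ρ θ.succ + γ := add_pos_of_nonneg_of_pos (hb.spectrum.nonneg θ.succ) hb.γ_pos
  have hrq : (ρ θ.succ + γ) / ρ θ.castSucc < 1 := by
    rw [div_lt_one hq]
    linarith [hb.spectrum.gap _ _ (Fin.castSucc_lt_succ (i := θ)), hb.γ_pos]
  obtain ⟨B, hB0, hB⟩ := hb.exists_tail_bound θ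
  refine ⟨fun ν => B * (((ρ θ.succ + γ) / ρ θ.castSucc) ^ ν *
    Real.exp (A * rate (multMax T (ρ θ.castSucc)) ν)), fun ν => by positivity, ?_,
    fun y hy ν => ?_⟩
  · simpa using (tendsto_pow_mul_exp_rate (one_le_multMax_of_pos (he θ)) (div_pos hr hq) hrq
      A).const_mul B
  have hv := (proj hb.isInternal θ.castSucc y).2
  have hw := sub_proj_mem_of_mem_upperSum hb.isInternal
    (fun i hi => hb.solSummand_le_slow (Fin.castSucc_lt_iff_succ_le.1 hi)) hy
  set v : solutionSpace n a m := (proj hb.isInternal θ.castSucc y).1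
  have htail : omega n ((y - v : solutionSpace n a m) : Set.Ici m → ℂ) ν ≤
      B * (ρ θ.succ + γ) ^ (ν : ℕ) * omega n (y : Set.Ici m → ℂ) (start m) := by
    simpa only [add_sub_cancel] using hB v hv (y - v) hw ν
  have htriangle : omega n (v : Set.Ici m → ℂ) ν ≤ omega n (y : Set.Ici m → ℂ) ν +
      omega n ((y - v : solutionSpace n a m) : Set.Ici m → ℂ) ν := by
    simpa only [Submodule.coe_sub, sub_sub_cancel] using
      omega_sub_le (y : Set.Ici m → ℂ) ((y - v : solutionSpace n a m) : Set.Ici m → ℂ) ν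
  calc _ = Real.exp (-A * rate (multMax T (ρ θ.castSucc)) ν) * ρ θ.castSucc ^ (ν : ℕ) *
          omega n (v : Set.Ici m → ℂ) (start m) -
        B * (ρ θ.succ + γ) ^ (ν : ℕ) * omega n (y : Set.Ici m → ℂ) (start m) := by
        beta_reduce
        rw [neg_mul, Real.exp_neg, div_pow]
        field_simp
    _ ≤ _ := by linarith [hA v hv ν]

lemma exists_isGrowthDecomposition (hlast : ρ (Fin.last s) = 0)
    (he : ∀ i : Fin s, 0 < multSum T (ρ i.castSucc)) :
    ∃ (A : ℝ) (α : ℕ → ℝ), IsGrowthDecomposition n s a T ρ A m α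
      fun i => solSummand n a T m γ (ρ i) := by
  obtain ⟨A, hA0, hdecay, hupper, hlower⟩ := ((eventually_gt_atTop 0).and
    ((hb.eventually_decay hlast).and ((eventually_all.2 (hb.eventually_upper he)).and
      (eventually_all.2 (hb.eventually_lower he))))).exists
  choose β hβ0 hβlim hβ using fun θ => hb.exists_lower_proj he θ (hlower θ)
  refine ⟨A, fun ν => 1 / ((ν : ℝ) + 1) + ∑ θ, β θ ν,
    { A_pos := hA0
      m_pos := hb.m_pos
      α_pos := fun ν _ => add_pos_of_pos_of_nonneg (by positivity)
        (Finset.sum_nonneg fun θ _ => hβ0 θ ν)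
      α_tendsto := ?_
      isInternal := hb.isInternal
      finrank_eq := hb.finrank_eq
      lower := hlower
      upper := fun θ y hy => hupper θ y (hb.upperSum_le_slow _ hy)
      lower_proj := fun θ y hy ν => le_trans ?_ (hβ θ y hy ν)
      decay := hdecay }⟩
  · simpa using tendsto_one_div_add_atTop_nhds_zero_nat.add
      (tendsto_finsetSum Finset.univ fun θ _ => hβlim θ)
  · have hle : β θ ν ≤ 1 / (((ν : ℕ) : ℝ) + 1) + ∑ θ, β θ ν :=
      le_add_of_nonneg_of_le (by positivity)
        (Finset.single_le_sum (fun θ _ => hβ0 θ ν) (Finset.mem_univ θ))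
    have hq := hb.pos θ
    have hω := omega_nonneg (n := n) (y : Set.Ici m → ℂ) (start m)
    gcongr

end IsBalanced

end Balanced

section Domination

/-- If the current leader `p` among the `r i` smaller than `r a` does not yet lose to `a` by the
factor `E`, waiting another `N` steps lets `a` win. -/
lemma exists_dominating {ι : Type*} [LinearOrder ι] {r w : ι → ℝ} {E : ℝ} {N : ℕ}
    (hr : ∀ i, 0 ≤ r i) (hw : ∀ i, 0 ≤ w i) (hE : 1 ≤ E)
    (hN : ∀ i j, i < j → E ^ 2 * r j ^ N ≤ r i ^ N) {S : Finset ι} (hS : S.Nonempty) :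
    ∃ t ≤ S.card * N, ∃ p ∈ S, ∀ j ∈ S, j ≠ p → E * (r j ^ t * w j) ≤ r p ^ t * w p := by
  induction S using Finset.induction_on_min with
  | empty => exact absurd hS Finset.not_nonempty_empty
  | insert a S ha ih =>
    have haS : a ∉ S := fun h => (ha a h).false
    rcases S.eq_empty_or_nonempty with rfl | hne
    · exact ⟨0, Nat.zero_le _, a, by simp, fun j hj hja => absurd (by simpa using hj) hja⟩
    obtain ⟨t, ht, p, hp, hdom⟩ := ih hne
    rw [Finset.card_insert_of_notMem haS, add_mul, one_mul]
    rcases le_or_gt (E * (r a ^ t * w a)) (r p ^ t * w p) with hap | hpa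
    · refine ⟨t, by omega, p, Finset.mem_insert_of_mem hp, fun j hj hjp => ?_⟩
      rcases Finset.mem_insert.1 hj with rfl | hj
      · exact hap
      · exact hdom j hj hjp
    refine ⟨t + N, by omega, a, Finset.mem_insert_self _ _, fun j hj hja => ?_⟩
    have hjS := (Finset.mem_insert.1 hj).resolve_left hja
    have hterm : ∀ i, 0 ≤ r i ^ t * w i := fun i => mul_nonneg (pow_nonneg (hr i) _) (hw i)
    have hjp : r j ^ t * w j ≤ r p ^ t * w p := by
      rcases eq_or_ne j p with rfl | h
      · exact le_rfl
      · exact (le_mul_of_one_le_left (hterm j) hE).trans (hdom j hjS h)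
    have hrj := hr j
    calc E * (r j ^ (t + N) * w j) = E * r j ^ N * (r j ^ t * w j) := by rw [pow_add]; ring
      _ ≤ E * r j ^ N * (E * (r a ^ t * w a)) :=
          mul_le_mul_of_nonneg_left (hjp.trans hpa.le) (by positivity)
      _ = E ^ 2 * r j ^ N * (r a ^ t * w a) := by ring
      _ ≤ r a ^ N * (r a ^ t * w a) :=
          mul_le_mul_of_nonneg_right (hN a j (ha j hjS)) (hterm a)
      _ = r a ^ (t + N) * w a := by rw [pow_add]; ring

variable {s : ℕ} {ρ : Fin (s + 1) → ℝ} (hρ : StrictAnti ρ)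

include hρ

lemma exists_ratio_gap : ∃ Q : ℝ, 1 < Q ∧ ∀ i j, i < j → Q * ρ j ≤ ρ i := by
  have h : ∀ᶠ Q : ℝ in 𝓝[>] 1, ∀ i j, i < j → Q * ρ j ≤ ρ i := by
    refine eventually_all.2 fun i => eventually_all.2 fun j => ?_
    by_cases hij : i < j
    · have hlim : Tendsto (fun Q : ℝ => Q * ρ j) (𝓝[>] 1) (𝓝 (1 * ρ j)) :=
        (Continuous.tendsto (by fun_prop) 1).mono_left nhdsWithin_le_nhds
      filter_upwards [hlim.eventually_lt_const (show 1 * ρ j < ρ i by simpa using hρ hij)]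
        with Q hQ _ using hQ.le
    · exact Eventually.of_forall fun Q h => absurd h hij
  obtain ⟨Q, hgap, hQ⟩ := (h.and self_mem_nhdsWithin).exists
  exact ⟨Q, hQ, hgap⟩

variable (hρ0 : ∀ i, 0 ≤ ρ i)

include hρ0

lemma exists_exp_mul_pow_le :
    ∃ c : ℝ, 0 < c ∧ ∀ x, 1 ≤ x → ∃ N : ℕ, (N : ℝ) ≤ c * x ∧
      ∀ i j, i < j → Real.exp x * ρ j ^ N ≤ ρ i ^ N := by
  obtain ⟨Q, hQ1, hQ⟩ := exists_ratio_gap hρ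
  have hlogQ := Real.log_pos hQ1
  refine ⟨(Real.log Q)⁻¹ + 1, by positivity, fun x hx =>
    ⟨⌈(Real.log Q)⁻¹ * x⌉₊, ?_, fun i j hij => ?_⟩⟩
  · linarith [(Nat.ceil_lt_add_one (show 0 ≤ (Real.log Q)⁻¹ * x by positivity)).le]
  set N := ⌈(Real.log Q)⁻¹ * x⌉₊
  have hexp : Real.exp x ≤ Q ^ N := by
    rw [← Real.le_log_iff_exp_le (by positivity), Real.log_pow, ← inv_mul_le_iff₀' hlogQ]
    exact Nat.le_ceil _
  have hρj := hρ0 j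
  calc Real.exp x * ρ j ^ N ≤ Q ^ N * ρ j ^ N := by gcongr
    _ = (Q * ρ j) ^ N := (mul_pow _ _ _).symm
    _ ≤ ρ i ^ N := by gcongr; exact hQ i j hij

lemma exists_dominating_le_mul {b : ℝ} (hb : 1 ≤ b) :
    ∃ c : ℝ, 0 < c ∧ ∀ g, 1 ≤ g → ∀ w : Fin (s + 1) → ℝ, (∀ i, 0 ≤ w i) → ∀ θ,
      ∃ t : ℕ, (t : ℝ) ≤ c * g ∧ ∃ p ≤ θ, ∀ j ≤ θ, j ≠ p →
        Real.exp (b * g) * (ρ j ^ t * w j) ≤ ρ p ^ t * w p := by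
  obtain ⟨c, hc, hN⟩ := exists_exp_mul_pow_le hρ hρ0
  refine ⟨(s + 1) * (c * (2 * b)), by positivity, fun g hg w hw θ => ?_⟩
  obtain ⟨N, hNle, hN⟩ := hN (2 * b * g) (by nlinarith)
  obtain ⟨t, ht, p, hp, hdom⟩ := exists_dominating (N := N) hρ0 hw
    (Real.one_le_exp (show 0 ≤ b * g by positivity))
    (fun i j hij => by
      rw [← Real.exp_nat_mul]
      convert hN i j hij using 3
      push_cast
      ring)
    (S := Finset.Iic θ) ⟨θ, Finset.mem_Iic.2 le_rfl⟩
  refine ⟨t, ?_, p, Finset.mem_Iic.1 hp, fun j hj => hdom j (Finset.mem_Iic.2 hj)⟩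
  have hcard : (Finset.Iic θ).card ≤ s + 1 := by
    simpa using Finset.card_le_univ (Finset.Iic θ)
  calc (t : ℝ) ≤ (s + 1) * N := by exact_mod_cast ht.trans (Nat.mul_le_mul_right N hcard)
    _ ≤ (s + 1) * (c * (2 * b * g)) := by gcongr
    _ = _ := by ring

end Domination

lemma le_mul_norm_sum_of_dominating {ι E : Type*} [SeminormedAddCommGroup E]
    {S : Finset ι} {x : ι → E} {d : ι → ℝ} {e K : ℝ} {p : ι} (hp : p ∈ S) (he : 0 ≤ e) (hK : 0 < K)
    (hcard : S.card ≤ K) (hdp : 0 ≤ d p) (hle : ∀ j ∈ S, ‖x j‖ ≤ e * d j) (hge : d p ≤ e * ‖x p‖)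
    (hdom : ∀ j ∈ S, j ≠ p → 2 * K * (e * e) * d j ≤ d p) :
    d p ≤ 2 * e * ‖∑ j ∈ S, x j‖ := by
  classical
  have hterm : ∀ j ∈ S.erase p, e * ‖x j‖ ≤ d p / (2 * K) := by
    intro j hj
    rw [le_div_iff₀ (by positivity)]
    calc e * ‖x j‖ * (2 * K) ≤ e * (e * d j) * (2 * K) := by
          gcongr; exact hle j (Finset.mem_of_mem_erase hj)
      _ = 2 * K * (e * e) * d j := by ring
      _ ≤ d p := hdom j (Finset.mem_of_mem_erase hj) (Finset.ne_of_mem_erase hj)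
  have hrest : e * ‖∑ j ∈ S.erase p, x j‖ ≤ d p / 2 :=
    calc e * ‖∑ j ∈ S.erase p, x j‖ ≤ ∑ j ∈ S.erase p, e * ‖x j‖ := by
          rw [← Finset.mul_sum]; gcongr; exact norm_sum_le _ _
      _ ≤ ((S.erase p).card : ℝ) * (d p / (2 * K)) := by
          rw [← nsmul_eq_mul]; exact Finset.sum_le_card_nsmul _ _ _ hterm
      _ ≤ K * (d p / (2 * K)) := by
          gcongr
          exact le_trans (by exact_mod_cast Finset.card_erase_le) hcard
      _ = d p / 2 := by field_simp
  have hsplit : ‖x p‖ ≤ ‖∑ j ∈ S, x j‖ + ‖∑ j ∈ S.erase p, x j‖ := by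
    rw [← Finset.add_sum_erase S x hp]
    exact norm_le_add_norm_add _ _
  linarith [mul_le_mul_of_nonneg_left hsplit he]

section Forward

variable {n m : ℕ} {a : ℕ → ℕ → ℂ}

lemma exists_sum_norm_coeff_le {aLim : ℕ → ℂ}
    (ha : ∀ i ≤ n, (fun ν : ℕ => a i ν - aLim i) =O[atTop] (fun ν : ℕ => 1 / ((ν : ℝ) + 1))) :
    ∃ C : ℝ, 1 ≤ C ∧ ∀ ν, ∑ k ∈ Finset.range n, ‖a k ν‖ ≤ C := by
  have hlim : Tendsto (fun ν => ∑ k ∈ Finset.range n, ‖a k ν‖) atTop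
      (𝓝 (∑ k ∈ Finset.range n, ‖aLim k‖)) := by
    refine tendsto_finsetSum _ fun k hk => Tendsto.norm ?_
    have := (ha k (Finset.mem_range.1 hk).le).trans_tendsto tendsto_one_div_add_atTop_nhds_zero_nat
    simpa using this.add_const (aLim k)
  obtain ⟨C, hC⟩ := hlim.bddAbove_range
  exact ⟨max 1 C, le_max_left _ _, fun ν => le_max_of_le_right (hC ⟨ν, rfl⟩)⟩

variable (ha_lead : ∀ ν : ℕ, a n ν = 1) {C : ℝ} (hC1 : 1 ≤ C)
  (hC : ∀ ν, ∑ k ∈ Finset.range n, ‖a k ν‖ ≤ C)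

include ha_lead hC1 hC

lemma omega_shift_one_le {y : Set.Ici m → ℂ} (hy : y ∈ solutionSpace n a m) (ν : Set.Ici m) :
    omega n y (shift ν 1) ≤ C * omega n y ν := by
  have hω := omega_nonneg (n := n) y ν
  refine omega_le (by positivity) fun j hj => ?_
  rw [shift_shift]
  rcases Nat.lt_or_ge (1 + j) n with h | h
  · exact (norm_le_omega y _ h).trans (le_mul_of_one_le_left hω hC1)
  obtain rfl : n = 1 + j := by omega
  calc ‖y (shift ν (1 + j))‖ ≤ ∑ k ∈ Finset.range (1 + j), ‖a k ν‖ * ‖y (shift ν k)‖ := by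
        rw [solution_apply_add ha_lead hy, norm_neg]
        exact (norm_sum_le _ _).trans_eq (Finset.sum_congr rfl fun k _ => norm_mul _ _)
    _ ≤ ∑ k ∈ Finset.range (1 + j), ‖a k ν‖ * omega (1 + j) y ν := by
        gcongr with k hk
        exact norm_le_omega y _ (Finset.mem_range.1 hk)
    _ ≤ C * omega (1 + j) y ν := by rw [← Finset.sum_mul]; gcongr; exact hC ν

lemma omega_shift_le {y : Set.Ici m → ℂ} (hy : y ∈ solutionSpace n a m) (ν : Set.Ici m) (t : ℕ) :
    omega n y (shift ν t) ≤ C ^ t * omega n y ν := by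
  induction t with
  | zero => rw [shift_zero, pow_zero, one_mul]
  | succ t ih =>
    rw [← shift_shift, pow_succ', mul_assoc]
    exact (omega_shift_one_le ha_lead hC1 hC hy _).trans
      (mul_le_mul_of_nonneg_left ih (zero_le_one.trans hC1))

/-- A bound `c * omega n y m ≤ omega n y ν` at a late `ν` passes to the earlier `ν` up to a
constant, because one step enlarges `omega` at most `C` times. -/
lemma exists_lower_of_forall_ge {k : ℕ} (hm : 1 ≤ m) {q A : ℝ} (hq : 0 < q)
    {W : Submodule ℂ (solutionSpace n a m)} {ν₀ : ℕ}
    (h : ∀ y ∈ W, ∀ ν : Set.Ici m, ν₀ ≤ ν → Real.exp (-A * rate k ν) * q ^ (ν : ℕ) *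
      omega n (y : Set.Ici m → ℂ) (start m) ≤ omega n (y : Set.Ici m → ℂ) ν) :
    ∃ A' : ℝ, 0 < A' ∧ ∀ y ∈ W, ∀ ν : Set.Ici m, Real.exp (-A' * rate k ν) * q ^ (ν : ℕ) *
      omega n (y : Set.Ici m → ℂ) (start m) ≤ omega n (y : Set.Ici m → ℂ) ν := by
  obtain ⟨M, hM⟩ : ∃ M, M = m + ν₀ := ⟨_, rfl⟩
  set c := Real.exp (-A * rate k M) * q ^ M / C ^ M with hc
  have hc0 : 0 < c := by positivity
  have hearly : ∀ y ∈ W, ∀ ν : Set.Ici m, (ν : ℕ) ≤ M →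
      c * omega n (y : Set.Ici m → ℂ) (start m) ≤ omega n (y : Set.Ici m → ℂ) ν := by
    intro y hy ν hν
    have hω := omega_nonneg (n := n) (y : Set.Ici m → ℂ) ν
    have hlate := h y hy (shift ν (M - ν)) (by rw [coe_shift]; omega)
    rw [coe_shift, Nat.add_sub_cancel' hν] at hlate
    rw [hc, div_mul_eq_mul_div, div_le_iff₀' (by positivity)]
    calc _ ≤ C ^ (M - (ν : ℕ)) * omega n (y : Set.Ici m → ℂ) ν :=
          hlate.trans (omega_shift_le ha_lead hC1 hC y.2 ν _)
      _ ≤ _ := by gcongr; exact Nat.sub_le _ _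
  have hlim : Tendsto (fun A' => Real.exp (-A') * max 1 q ^ M) atTop (𝓝 0) := by
    simpa using Real.tendsto_exp_neg_atTop_nhds_zero.mul_const (max 1 q ^ M)
  obtain ⟨A', hsmall, hAA', hA'⟩ := ((hlim.eventually_le_const hc0).and
    ((eventually_ge_atTop A).and (eventually_gt_atTop 0))).exists
  refine ⟨A', hA', fun y hy ν => ?_⟩
  have hr : 1 ≤ rate k ν := one_le_rate k (hm.trans ν.2)
  have hω := omega_nonneg (n := n) (y : Set.Ici m → ℂ) (start m)
  rcases Nat.le_total ν M with hν | hν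
  · refine le_trans (mul_le_mul_of_nonneg_right ?_ hω) (hearly y hy ν hν)
    calc Real.exp (-A' * rate k ν) * q ^ (ν : ℕ) ≤ Real.exp (-A') * max 1 q ^ M := by
          gcongr
          · nlinarith
          · exact (pow_le_pow_left₀ hq.le (le_max_right 1 q) _).trans
              (pow_le_pow_right₀ (le_max_left 1 q) hν)
      _ ≤ c := hsmall
  · refine le_trans ?_ (h y hy ν (by omega))
    gcongr

end Forward

lemma pow_le_pow_mul_exp {C q x : ℝ} {t : ℕ} (hC : 0 ≤ C) (hq : 0 < q) (ht : (t : ℝ) ≤ x) :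
    C ^ t ≤ q ^ t * Real.exp (x * Real.log (max 1 (C / q))) := by
  have hone : 1 ≤ max 1 (C / q) := le_max_left _ _
  calc C ^ t = q ^ t * (C / q) ^ t := by rw [← mul_pow, mul_div_cancel₀ _ hq.ne']
    _ ≤ q ^ t * max 1 (C / q) ^ t := by gcongr; exact le_max_right _ _
    _ = q ^ t * Real.exp (t * Real.log (max 1 (C / q))) := by
        rw [Real.exp_nat_mul, Real.exp_log (by positivity)]
    _ ≤ _ := by
        have := Real.log_nonneg hone
        gcongr

namespace IsGrowthDecomposition

variable {n s m : ℕ} {a : ℕ → ℕ → ℂ} {T : ℂ[X]} {ρ : Fin (s + 1) → ℝ} {A : ℝ} {α : ℕ → ℝ}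
  {V : Fin (s + 1) → Submodule ℂ (solutionSpace n a m)}
  (h : IsGrowthDecomposition n s a T ρ A m α V)

/-- The size at `ν` that the growth rate `ρ j` predicts for the `j`-th component of `y`. -/
noncomputable def predictedSize (y : solutionSpace n a m) (ν : ℕ) (j : Fin (s + 1)) : ℝ :=
  ρ j ^ ν * omega n ((proj h.isInternal j y : solutionSpace n a m) : Set.Ici m → ℂ) (start m)

variable {θ : Fin s} {y : solutionSpace n a m} {ν : Set.Ici m} {G : ℝ}

lemma predictedSize_add (ν t : ℕ) (j : Fin (s + 1)) :
    h.predictedSize y (ν + t) j = ρ j ^ t * h.predictedSize y ν j := by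
  rw [predictedSize, predictedSize, pow_add]
  ring

include h

section Summand

variable (hρ0 : 0 ≤ ρ θ.castSucc) (hy : y ∈ V θ.castSucc)
  (hG : rate (multMax T (ρ θ.castSucc)) ν ≤ G)

include hρ0 hy hG

lemma omega_le_of_mem : omega n (y : Set.Ici m → ℂ) ν ≤ Real.exp (A * G) *
    (ρ θ.castSucc ^ (ν : ℕ) * omega n (y : Set.Ici m → ℂ) (start m)) := by
  have hω := omega_nonneg (n := n) (y : Set.Ici m → ℂ) (start m)
  have hmem : y ∈ upperSum V θ.castSucc :=
    Submodule.mem_iSup_of_mem θ.castSucc (Submodule.mem_iSup_of_mem le_rfl hy)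
  refine (h.upper θ y hmem ν).trans ?_
  rw [mul_assoc]
  gcongr
  exact h.A_pos.le

lemma le_omega_of_mem : ρ θ.castSucc ^ (ν : ℕ) * omega n (y : Set.Ici m → ℂ) (start m) ≤
    Real.exp (A * G) * omega n (y : Set.Ici m → ℂ) ν := by
  have hω := omega_nonneg (n := n) (y : Set.Ici m → ℂ) (start m)
  have hexp : Real.exp (-(A * G)) ≤ Real.exp (-A * rate (multMax T (ρ θ.castSucc)) ν) := by
    rw [neg_mul]
    gcongr
    exact h.A_pos.le
  rw [← inv_mul_le_iff₀ (Real.exp_pos _), ← Real.exp_neg, ← mul_assoc]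
  exact le_trans (by gcongr) (h.lower θ y hy ν)

end Summand

variable (hρ0 : ∀ i, 0 ≤ ρ i)

include hρ0

lemma predictedSize_nonneg (ν : ℕ) (j : Fin (s + 1)) : 0 ≤ h.predictedSize y ν j :=
  mul_nonneg (pow_nonneg (hρ0 j) _) (omega_nonneg _ _)

lemma pow_mul_omega_start_le (hρ : Antitone ρ) (hy : y ∈ lowerSum V θ.castSucc) {ν : ℕ}
    {p : Fin (s + 1)} (hp : ∀ j ≤ θ.castSucc, h.predictedSize y ν j ≤ h.predictedSize y ν p) :
    ρ θ.castSucc ^ ν * omega n (y : Set.Ici m → ℂ) (start m) ≤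
      (s + 1) * h.predictedSize y ν p := by
  have hq := hρ0 θ.castSucc
  have hpos := h.predictedSize_nonneg (y := y) hρ0 ν p
  have hcard : ((Finset.Iic θ.castSucc).card : ℝ) ≤ s + 1 := by
    exact_mod_cast (Finset.card_le_univ _).trans_eq (Fintype.card_fin _)
  have hterm : ∀ j ∈ Finset.Iic θ.castSucc, ρ θ.castSucc ^ ν * omega n
      ((proj h.isInternal j y : solutionSpace n a m) : Set.Ici m → ℂ) (start m) ≤
        h.predictedSize y ν p := fun j hj =>
    (mul_le_mul_of_nonneg_right (pow_le_pow_left₀ hq (hρ (Finset.mem_Iic.1 hj)) ν)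
      (omega_nonneg _ _)).trans (hp j (Finset.mem_Iic.1 hj))
  calc ρ θ.castSucc ^ ν * omega n (y : Set.Ici m → ℂ) (start m)
    _ ≤ ρ θ.castSucc ^ ν * ∑ j ∈ Finset.Iic θ.castSucc, omega n
          ((proj h.isInternal j y : solutionSpace n a m) : Set.Ici m → ℂ) (start m) := by
        conv_lhs => rw [← sum_proj_of_mem_lowerSum h.isInternal hy, Submodule.coe_sum]
        gcongr
        exact omega_sum_le _ _ _
    _ ≤ (Finset.Iic θ.castSucc).card * h.predictedSize y ν p := by
        rw [Finset.mul_sum, ← nsmul_eq_mul]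
        exact Finset.sum_le_card_nsmul _ _ _ hterm
    _ ≤ (s + 1) * h.predictedSize y ν p := by gcongr

lemma predictedSize_le_of_dominating (hy : y ∈ lowerSum V θ.castSucc)
    (hG : ∀ j : Fin s, rate (multMax T (ρ j.castSucc)) ν ≤ G)
    {p : Fin (s + 1)} (hp : p ≤ θ.castSucc)
    (hdom : ∀ j ≤ θ.castSucc, j ≠ p →
      2 * (s + 1) * (Real.exp (A * G) * Real.exp (A * G)) * h.predictedSize y ν j ≤
        h.predictedSize y ν p) :
    h.predictedSize y ν p ≤ 2 * Real.exp (A * G) * omega n (y : Set.Ici m → ℂ) ν := by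
  have hcast : ∀ j ≤ θ.castSucc, ∃ i : Fin s, j = i.castSucc := fun j hj =>
    ⟨j.castLT (lt_of_le_of_lt (Fin.le_def.1 hj) θ.2), rfl⟩
  have hbound := le_mul_norm_sum_of_dominating (S := Finset.Iic θ.castSucc) (K := s + 1)
    (x := fun j (i : Fin n) =>
      ((proj h.isInternal j y : solutionSpace n a m) : Set.Ici m → ℂ) (shift ν i))
    (d := h.predictedSize y ν) (Finset.mem_Iic.2 hp) (Real.exp_pos (A * G)).le (by positivity)
    (by exact_mod_cast (Finset.card_le_univ _).trans_eq (Fintype.card_fin _))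
    (h.predictedSize_nonneg hρ0 ν p)
    (fun j hj => by
      obtain ⟨i, rfl⟩ := hcast j (Finset.mem_Iic.1 hj)
      exact h.omega_le_of_mem (hρ0 _) (proj h.isInternal i.castSucc y).2 (hG i))
    (by
      obtain ⟨i, rfl⟩ := hcast p hp
      exact h.le_omega_of_mem (hρ0 _) (proj h.isInternal i.castSucc y).2 (hG i))
    (fun j hj => hdom j (Finset.mem_Iic.1 hj))
  convert hbound using 2
  conv_lhs => rw [← sum_proj_of_mem_lowerSum h.isInternal hy, Submodule.coe_sum]
  rw [omega]
  congr 1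
  ext i
  simp only [Finset.sum_apply]

variable (hρ : StrictAnti ρ) {k : ℕ} (hk : ∀ j : Fin s, multMax T (ρ j.castSucc) ≤ k)
  (he : ∀ i : Fin s, 0 < multSum T (ρ i.castSucc))

include hρ hk he

lemma exists_pow_mul_omega_start_le_omega_shift :
    ∃ c : ℝ, 0 < c ∧ ∀ θ : Fin s, ∀ y ∈ lowerSum V θ.castSucc, ∀ ν : Set.Ici m,
      c * rate k ν ≤ ν → ∃ t : ℕ, (t : ℝ) ≤ c * rate k ν ∧
        ρ θ.castSucc ^ ((ν : ℕ) + t) * omega n (y : Set.Ici m → ℂ) (start m) ≤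
          2 * (s + 1) * Real.exp (4 * A * rate k ν) *
            omega n (y : Set.Ici m → ℂ) (shift ν t) := by
  have hA := h.A_pos
  obtain ⟨c, hc, hdom⟩ := exists_dominating_le_mul hρ hρ0
    (show 1 ≤ 2 * ((s : ℝ) + 1) + 8 * A by linarith [(s.cast_nonneg : (0 : ℝ) ≤ s)])
  refine ⟨c, hc, fun θ y hy ν hcν => ?_⟩
  have hν := h.m_pos.trans ν.2
  have hg := one_le_rate k hν
  obtain ⟨t, ht, p, hp, hdom⟩ := hdom (rate k ν) hg (h.predictedSize y ν)
    (h.predictedSize_nonneg hρ0 ν) θ.castSucc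
  refine ⟨t, ht, ?_⟩
  simp only [← predictedSize_add] at hdom
  have hG : ∀ j : Fin s, rate (multMax T (ρ j.castSucc)) (shift ν t : Set.Ici m) ≤
      4 * rate k ν := by
    intro j
    have hνt := h.m_pos.trans (shift ν t).2
    refine (rate_mono (one_le_multMax_of_pos (he j)) (hk j) hνt).trans ?_
    have hdouble := rate_le_mul k hν hνt one_le_two (by rw [coe_shift]; push_cast; linarith)
    linarith
  have hpos := fun j => h.predictedSize_nonneg (y := y) hρ0 (ν + t) j
  have hexp : 2 * ((s : ℝ) + 1) * (Real.exp (A * (4 * rate k ν)) * Real.exp (A * (4 * rate k ν))) ≤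
      Real.exp ((2 * ((s : ℝ) + 1) + 8 * A) * rate k ν) := by
    rw [← Real.exp_add, show A * (4 * rate k ν) + A * (4 * rate k ν) = 8 * A * rate k ν by ring]
    exact mul_exp_le_exp_add (by positivity) hg le_rfl
  have hmax : ∀ j ≤ θ.castSucc,
      h.predictedSize y (ν + t) j ≤ h.predictedSize y (ν + t) p := by
    intro j hj
    rcases eq_or_ne j p with rfl | hjp
    · exact le_rfl
    · exact (le_mul_of_one_le_left (hpos j) (Real.one_le_exp (by positivity))).trans
        (hdom j hj hjp)
  calc ρ θ.castSucc ^ ((ν : ℕ) + t) * omega n (y : Set.Ici m → ℂ) (start m)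
    _ ≤ (s + 1) * h.predictedSize y (ν + t) p :=
        h.pow_mul_omega_start_le hρ0 hρ.antitone hy hmax
    _ ≤ (s + 1) * (2 * Real.exp (A * (4 * rate k ν)) *
          omega n (y : Set.Ici m → ℂ) (shift ν t)) := by
        gcongr
        exact h.predictedSize_le_of_dominating (ν := shift ν t) hρ0 hy hG hp fun j hj hjp =>
          (mul_le_mul_of_nonneg_right hexp (hpos j)).trans (hdom j hj hjp)
    _ = _ := by
        rw [show A * (4 * rate k ν) = 4 * A * rate k ν by ring]
        ring

lemma exists_lower_lowerSum (ha_lead : ∀ ν : ℕ, a n ν = 1) {C : ℝ} (hC1 : 1 ≤ C)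
    (hC : ∀ ν, ∑ k ∈ Finset.range n, ‖a k ν‖ ≤ C) (θ : Fin s) (hq : 0 < ρ θ.castSucc) :
    ∃ A' : ℝ, 0 < A' ∧ ∀ y ∈ lowerSum V θ.castSucc, ∀ ν : Set.Ici m,
      Real.exp (-A' * rate k ν) * ρ θ.castSucc ^ (ν : ℕ) *
        omega n (y : Set.Ici m → ℂ) (start m) ≤ omega n (y : Set.Ici m → ℂ) ν := by
  obtain ⟨c, hc, hshift⟩ := h.exists_pow_mul_omega_start_le_omega_shift hρ0 hρ hk he
  have hk1 : 1 ≤ k := (one_le_multMax_of_pos (he θ)).trans (hk θ)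
  have hsmall := (tendsto_rate_div hk1).eventually_le_const (show 0 < 1 / c by positivity)
  obtain ⟨ν₀, hν₀⟩ := eventually_atTop.1 hsmall
  set q := ρ θ.castSucc
  set L := Real.log (max 1 (C / q))
  refine exists_lower_of_forall_ge ha_lead hC1 hC h.m_pos hq (ν₀ := ν₀)
    (A := 2 * ((s : ℝ) + 1) + (4 * A + c * L)) fun y hy ν hν => ?_
  have hν1 := h.m_pos.trans ν.2
  have hg := one_le_rate k hν1
  have hcν : c * rate k ν ≤ ν := by
    have := hν₀ ν hν
    rwa [div_le_div_iff₀ (by exact_mod_cast hν1) hc, one_mul, mul_comm] at this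
  obtain ⟨t, ht, hlate⟩ := hshift θ y hy ν hcν
  have hω := omega_nonneg (n := n) (y : Set.Ici m → ℂ) ν
  have hstep : omega n (y : Set.Ici m → ℂ) (shift ν t) ≤
      q ^ t * Real.exp (c * L * rate k ν) * omega n (y : Set.Ici m → ℂ) ν := by
    refine (omega_shift_le ha_lead hC1 hC y.2 ν t).trans ?_
    rw [mul_right_comm c L]
    gcongr
    exact pow_le_pow_mul_exp (zero_le_one.trans hC1) hq ht
  rw [neg_mul, Real.exp_neg, mul_assoc, inv_mul_le_iff₀ (Real.exp_pos _)]
  refine le_of_mul_le_mul_left ?_ (pow_pos hq t)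
  calc q ^ t * (q ^ (ν : ℕ) * omega n (y : Set.Ici m → ℂ) (start m))
    _ = q ^ ((ν : ℕ) + t) * omega n (y : Set.Ici m → ℂ) (start m) := by rw [pow_add]; ring
    _ ≤ _ := hlate
    _ ≤ 2 * (s + 1) * Real.exp (4 * A * rate k ν) *
          (q ^ t * Real.exp (c * L * rate k ν) * omega n (y : Set.Ici m → ℂ) ν) := by gcongr
    _ = q ^ t * (2 * (s + 1) * Real.exp ((4 * A + c * L) * rate k ν) *
          omega n (y : Set.Ici m → ℂ) ν) := by
        rw [add_mul (4 * A), Real.exp_add]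
        ring
    _ ≤ _ := by
        gcongr
        exact mul_exp_le_exp_add (by positivity) hg le_rfl

end IsGrowthDecomposition

end PoincareEq

theorem theorem8 (s n : ℕ) (hn : 1 ≤ n) (a : ℕ → ℕ → ℂ) (aLim : ℕ → ℂ)
    (ha_lead : ∀ ν : ℕ, a n ν = 1)
    (ha : ∀ i ≤ n, (fun ν : ℕ => a i ν - aLim i) =O[atTop] (fun ν : ℕ => 1 / ((ν : ℝ) + 1)))
    (ρ : Fin (s + 1) → ℝ) (hρ : StrictAnti ρ) (hρ_last : ρ (Fin.last s) = 0)
    (hroots : ∀ z ∈ (charPol n aLim).roots, ∃ i : Fin (s + 1), ‖z‖ = ρ i)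
    (he : ∀ i : Fin s, 0 < multSum (charPol n aLim) (ρ i.castSucc)) :
    (∃ (A : ℝ) (m : ℕ) (α : ℕ → ℝ) (V : Fin (s + 1) → Submodule ℂ (solutionSpace n a m)),
        IsGrowthDecomposition n s a (charPol n aLim) ρ A m α V) ∧
    ∀ (A : ℝ) (m : ℕ) (α : ℕ → ℝ) (V : Fin (s + 1) → Submodule ℂ (solutionSpace n a m)),
      IsGrowthDecomposition n s a (charPol n aLim) ρ A m α V →
      ∀ θ : Fin s, ∃ Astar : ℝ, 0 < Astar ∧
        ∀ y ∈ lowerSum V θ.castSucc, ∀ ν : Set.Ici m,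
          Real.exp (-Astar *
              rate (Finset.univ.sup fun i : Fin s => multMax (charPol n aLim) (ρ i.castSucc)) ν)
            * ρ θ.castSucc ^ (ν : ℕ) * omega n (y : Set.Ici m → ℂ) (start m)
          ≤ omega n (y : Set.Ici m → ℂ) ν := by
  refine ⟨?_, fun A m α V h θ => ?_⟩
  · obtain ⟨m, γ, C, D, hb⟩ := exists_isBalanced hn ha_lead ha hρ hρ_last hroots
    obtain ⟨A, α, h⟩ := hb.exists_isGrowthDecomposition hρ_last he
    exact ⟨A, m, α, _, h⟩
  · have hρ0 : ∀ i, 0 ≤ ρ i := fun i => hρ_last ▸ hρ.antitone (Fin.le_last i)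
    have hq : 0 < ρ θ.castSucc := hρ_last ▸ hρ (Fin.castSucc_lt_last θ)
    obtain ⟨C, hC1, hC⟩ := exists_sum_norm_coeff_le ha
    exact h.exists_lower_lowerSum hρ0 hρ (fun j => Finset.le_sup
      (f := fun i : Fin s => multMax (charPol n aLim) (ρ i.castSucc)) (Finset.mem_univ j))
      he ha_lead hC1 hC θ hq
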